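/- Let $(X_k)_{k\ge1}$ be independent real random variables with $\mathbb E[X_k]=0$ and $\mathrm{Var}(X_k)=1$, such that each $X_k$ has a density $p_k$ supported on an interval of $\mathbb R$ (bounded or unbounded), positive and differentiable in the interior of that interval. Let $$\tau_k(x)=\frac{1}{p_k(x)}\int_x^\infty y\,p_k(y)\,dy$$ be the Stein kernel of $X_k$. Let $H:\mathbb R\to\mathbb R$ be twice differentiable with $H'$ and $H''$ bounded and $H'(0)\neq0$, and put, for $n\ge1$, $$\bar X=\frac{X_1+\dots+X_n}{n},\qquad F_n=\sqrt n\,\bigl(H(\bar X)-\mathbb E[H(\bar X)]\bigr),\qquad \sigma_n^2=\mathrm{Var}(F_n),\qquad \nabla_{F_n}=\frac{H'(0)H'(\bar X)}{n}\sum_{k=1}^n\tau_k(X_k).$$ Assume that $$\beta:=\max\Bigl\{\sup_{k\ge1}\mathbb E|X_k|^8,\ \sup_{k\ge1}\mathbb E|\tau_k(X_k)|^8,\ \sup_{k\ge1}\mathbb E|\tau_k'(X_k)|^8\Bigr\}<\infty .$$ For a random variable $F$ with mean $\mu$ and variance $\sigma^2>0$, the Fisher information distance to $Z\sim N(\mu,\sigma^2)$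 is $I(F\|Z)=\mathbb E\bigl[\bigl(\rho_F(F)+\tfrac{F-\mu}{\sigma^2}\bigr)^2\bigr]$, where $\rho_F=p_F'/p_F$ and $p_F$ is the absolutely continuous density of $F$; if $F$ has no such density, $I(F\|Z)=\infty$. Then there is a constant $C>0$ depending only on $\beta$, $\|H'\|_\infty=\sup_x|H'(x)|$ and $\|H''\|_\infty=\sup_x|H''(x)|$ such that, for all $n\ge1$, $$\bigl|\sigma_n^2-|H'(0)|^2\bigr|\le\frac{C}{\sqrt n}$$ and, with $Z\sim N(0,1)$, $$I(\sigma_n^{-1}F_n\|Z)\le\frac{C}{n\sigma_n^2}\Bigl(1+\|\nabla_{F_n}^{-1}\|_8^2+\|\nabla_{F_n}^{-1}\|_8^4\Bigr).$$ Here $\|\nabla_{F_n}^{-1}\|_8=(\mathbb E|\nabla_{F_n}|^{-8})^{1/8}\in(0,\infty]$ with $0^{-1}=\infty$, and the right-hand side is $\infty$ if $\sigma_n=0$ or $\|\nabla_{F_n}^{-1}\|_8=\infty$; in particular, if it is finite then $\sigma_n^{-1}F_n$ has an absolutely continuous density. -/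

import Mathlib

open MeasureTheory ProbabilityTheory
open scoped ENNReal NNReal

noncomputable section

namespace FisherCLT

/-- `p` is a density of the law `μ`, supported on an interval `I` (bounded or not, with or without
its end points), positive and differentiable in the interior of `I`. -/
structure IsIntervalDensity (μ : Measure ℝ) (p : ℝ → ℝ) : Prop where
  law : μ = volume.withDensity (fun x => ENNReal.ofReal (p x))
  nonneg : ∀ x, 0 ≤ p x
  interval : ∃ I : Set ℝ, I.OrdConnected ∧ (∀ x, x ∉ I → p x = 0) ∧
    ∀ x ∈ interior I, 0 < p x ∧ DifferentiableAt ℝ p x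

/-- The Stein kernel `τ(x) = (∫_x^∞ (y - m) p(y) dy) / p(x)` of a law with density `p`
and mean `m = ∫ z p(z) dz`. -/
def steinKernel (p : ℝ → ℝ) (x : ℝ) : ℝ :=
  (∫ y in Set.Ioi x, (y - ∫ z, z * p z) * p y) / p x

/-- `q` is an absolutely continuous density of the law `μ`, with Radon-Nikodym derivative `q'`
(that is, `q` is an indefinite integral of the locally integrable function `q'`). -/
structure IsACDensity (μ : Measure ℝ) (q q' : ℝ → ℝ) : Prop where
  law : μ = volume.withDensity (fun x => ENNReal.ofReal (q x))
  nonneg : ∀ x, 0 ≤ q x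
  locallyIntegrable : LocallyIntegrable q' volume
  integral_eq : ∀ x y, q y - q x = ∫ t in x..y, q' t

/-- The Fisher information distance `I(F‖Z) = E[(ρ_F(F) + (F - m) / v)²]` of a random variable `F`
with mean `m` and variance `v` to the normal law `Z ∼ N(m, v)`, where `ρ_F = q' / q` is the score
function of the absolutely continuous density `q` of `F`. The density `q` is unique and `q'` is
unique almost everywhere, so the infimum is over one value; if there is no such density,
the infimum is over the empty set and the distance is `∞`. -/
def fisherDist {Ω : Type*} [MeasurableSpace Ω] (P : Measure Ω) (F : Ω → ℝ) : ℝ≥0∞ :=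
  ⨅ (q : ℝ → ℝ) (q' : ℝ → ℝ) (_ : IsACDensity (P.map F) q q'),
    ∫⁻ ω, ‖q' (F ω) / q (F ω) + (F ω - P[F]) / Var[F; P]‖ₑ ^ 2 ∂P

/-- The sample mean of the first `n` terms of the sequence. -/
def sampleMean {Ω : Type*} (X : ℕ → Ω → ℝ) (n : ℕ) (ω : Ω) : ℝ :=
  (∑ k ∈ Finset.range n, X k ω) / n

/-- The statistic `F_n = √n (H(X̄) - E[H(X̄)])`. -/
def statF {Ω : Type*} [MeasurableSpace Ω] (P : Measure Ω) (X : ℕ → Ω → ℝ) (H : ℝ → ℝ)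
    (n : ℕ) (ω : Ω) : ℝ :=
  √n * (H (sampleMean X n ω) - ∫ ω', H (sampleMean X n ω') ∂P)

/-- `∇_{F_n} = H'(0) H'(X̄) n⁻¹ ∑ τ_k(X_k)`, where `p k` is the density of `X k`. -/
def nablaF {Ω : Type*} (X : ℕ → Ω → ℝ) (p : ℕ → ℝ → ℝ) (H : ℝ → ℝ) (n : ℕ) (ω : Ω) : ℝ :=
  deriv H 0 * deriv H (sampleMean X n ω) / n *
    ∑ k ∈ Finset.range n, steinKernel (p k) (X k ω)

/-- `β = max {sup_k E|X_k|⁸, sup_k E|τ_k(X_k)|⁸, sup_k E|τ_k'(X_k)|⁸}`, possibly infinite. -/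
def momentBound {Ω : Type*} [MeasurableSpace Ω] (P : Measure Ω) (X : ℕ → Ω → ℝ)
    (p : ℕ → ℝ → ℝ) : ℝ≥0∞ :=
  max (⨆ k, ∫⁻ ω, ‖X k ω‖ₑ ^ 8 ∂P)
    (max (⨆ k, ∫⁻ ω, ‖steinKernel (p k) (X k ω)‖ₑ ^ 8 ∂P)
      (⨆ k, ∫⁻ ω, ‖deriv (steinKernel (p k)) (X k ω)‖ₑ ^ 8 ∂P))

/-- `‖Y⁻¹‖_r = (E|Y|^{-r})^{1/r}`, with `0⁻¹ = ∞`. -/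
def invNorm {Ω : Type*} [MeasurableSpace Ω] (P : Measure Ω) (Y : Ω → ℝ) (r : ℝ) : ℝ≥0∞ :=
  (∫⁻ ω, (‖Y ω‖ₑ⁻¹) ^ r ∂P) ^ (1 / r)

end FisherCLT

end

/-! A centred law with density p and Stein kernel τ satisfies E[X G(X)] = E[τ(X) G'(X)] for bounded
G, because (pτ)' = -xp and the boundary terms vanish. Write c = H'(0), r = √n, σ = σ_n, S = ∑ X_k, T
= ∑ τ_k(X_k), D = ∇_{F_n} and F = F_n/σ. For each k the identity is applied in the variable X_k, the
others being frozen, to the function φ(F)/D, and the results are summed. The point of ∇ is that ∑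
τ_k ∂_k F = (r/(σc)) D, so that the derivative of φ(F) cancels the factor 1/D. This leaves E[φ'(F)]
= E[φ(F) W] with W = (σc/r)(S/D + Q/D²) and Q = ∑ τ_k ∂_k D (`integral_sum_inv`).

Such a formula determines the law of F. If w(F) = E[W | F], then F has the density q(t) = E[w(F); F
> t], which satisfies q' = -wq, so its score is -w (`exists_isACDensity`). Since F has mean 0 and
variance 1, the Fisher distance is ‖E[F - W | F]‖₂² ≤ ‖F - W‖₂² (`fisherDist_le_eLpNorm`).

Finally F - W = σ⁻¹[(F_n - cS/r) + (c/r)(S/D)(D - σ²) - σ²(c/r) Q/D²], and every term is O(1/r). The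
first is a Taylor remainder. In the second, D is close to c² because the τ_k(X_k) have mean 1 and
H'(X̄) is close to c, while σ² is close to c² by the same linearization. In the third, Q is bounded
in L⁴. Hölder's inequality, with exponents 8, 8 → 4 and 4, 4 → 2, separates the powers of ‖D⁻¹‖₈.
The L⁸ norms of S and T - n are O(r) by an induction on the number of summands
(`integral_sum_range_pow_eight_le`). -/

noncomputable section

namespace FisherCLT

open Set Filter Topology

/-! ### Interval densities and the Stein identity. -/

/-- The interior of the interval carrying an interval density. -/
theorem IsIntervalDensity.exists_isOpen {μ : Measure ℝ} {p : ℝ → ℝ} (hp : IsIntervalDensity μ p) :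
    ∃ J : Set ℝ, IsOpen J ∧ J.OrdConnected ∧ (∀ᵐ x, x ∉ J → p x = 0) ∧
      ∀ x ∈ J, 0 < p x ∧ DifferentiableAt ℝ p x := by
  obtain ⟨I, hI, hI0, hI1⟩ := hp.interval
  refine ⟨interior I, isOpen_interior, hI.interior, ?_, hI1⟩
  have h : volume (frontier I) = 0 := hI.convex.addHaar_frontier volume
  filter_upwards [measure_eq_zero_iff_ae_notMem.1 h] with x hx hxJ
  refine hI0 x fun hxI => hx ?_
  exact ⟨subset_closure hxI, hxJ⟩

theorem IsIntervalDensity.aemeasurable {μ : Measure ℝ} {p : ℝ → ℝ} (hp : IsIntervalDensity μ p) :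
    AEMeasurable p volume := by
  classical
  obtain ⟨J, hJ, -, h0, h1⟩ := hp.exists_isOpen
  refine ⟨J.piecewise p 0, ?_, ?_⟩
  · exact ContinuousOn.measurable_piecewise
      (fun x hx => (h1 x hx).2.continuousAt.continuousWithinAt) continuousOn_const hJ.measurableSet
  · filter_upwards [h0] with x hx
    by_cases hxJ : x ∈ J <;> simp [hxJ, hx]

theorem IsIntervalDensity.integrable_iff {μ : Measure ℝ} {p : ℝ → ℝ} (hp : IsIntervalDensity μ p)
    (g : ℝ → ℝ) : Integrable g μ ↔ Integrable (fun x => p x * g x) := by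
  rw [hp.law, integrable_withDensity_iff_integrable_smul₀' hp.aemeasurable.ennreal_ofReal
    (by simp)]
  simp only [ENNReal.toReal_ofReal (hp.nonneg _), smul_eq_mul]

theorem IsIntervalDensity.integral_eq {μ : Measure ℝ} {p : ℝ → ℝ} (hp : IsIntervalDensity μ p)
    (g : ℝ → ℝ) : ∫ x, g x ∂μ = ∫ x, p x * g x := by
  rw [hp.law, integral_withDensity_eq_integral_toReal_smul₀ hp.aemeasurable.ennreal_ofReal
    (by simp)]
  simp only [ENNReal.toReal_ofReal (hp.nonneg _), smul_eq_mul]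

/-- `τ`, with derivative `τ'` on the open set `J` carrying `μ`, is a Stein kernel of the centered
law `μ`: it satisfies the integration by parts formula against bounded differentiable functions. -/
structure IsSteinKernel (μ : Measure ℝ) (J : Set ℝ) (τ τ' : ℝ → ℝ) : Prop where
  measurableSet : MeasurableSet J
  ae_mem : ∀ᵐ x ∂μ, x ∈ J
  measurable : Measurable τ
  measurable_deriv : Measurable τ'
  hasDerivAt : ∀ x ∈ J, HasDerivAt τ (τ' x) x
  integral_mul : ∀ (G G' : ℝ → ℝ) (C : ℝ), (∀ x ∈ J, HasDerivAt G (G' x) x) →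
    (∀ x ∈ J, |G x| ≤ C) → Integrable (fun x => τ x * G' x) μ →
    ∫ x, x * G x ∂μ = ∫ x, τ x * G' x ∂μ

section Tail

variable {f : ℝ → ℝ}

theorem integral_Ioi_sub (hf : Integrable f) (x y : ℝ) :
    (∫ t in Ioi y, f t) = (∫ t in Ioi x, f t) - ∫ t in x..y, f t := by
  have := intervalIntegral.integral_interval_add_Ioi (a := x) (b := y) hf.integrableOn
    hf.integrableOn
  linarith

theorem continuous_integral_Ioi (hf : Integrable f) : Continuous fun x => ∫ t in Ioi x, f t := by
  have : (fun x => ∫ t in Ioi x, f t) = fun y =>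
      (∫ t in Ioi (0 : ℝ), f t) - ∫ t in (0 : ℝ)..y, f t :=
    funext fun y => integral_Ioi_sub hf 0 y
  rw [this]
  exact continuous_const.sub (intervalIntegral.continuous_primitive
    (fun a b => hf.intervalIntegrable) 0)

theorem hasDerivAt_integral_Ioi (hf : Integrable f) {x : ℝ} (hx : ContinuousAt f x)
    (hm : StronglyMeasurableAtFilter f (𝓝 x)) :
    HasDerivAt (fun x => ∫ t in Ioi x, f t) (-f x) x := by
  have : (fun x => ∫ t in Ioi x, f t) = fun y =>
      (∫ t in Ioi (0 : ℝ), f t) - ∫ t in (0 : ℝ)..y, f t :=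
    funext fun y => integral_Ioi_sub hf 0 y
  rw [this]
  simpa using (intervalIntegral.integral_hasDerivAt_right hf.intervalIntegrable hm hx).const_sub
    (∫ t in Ioi (0 : ℝ), f t)

theorem tendsto_integral_Ioi_atTop (hf : Integrable f) :
    Tendsto (fun x => ∫ t in Ioi x, f t) atTop (𝓝 0) := by
  have h := intervalIntegral_tendsto_integral_Ioi 0 hf.integrableOn tendsto_id
  have : (fun x => ∫ t in Ioi x, f t) = fun y =>
      (∫ t in Ioi (0 : ℝ), f t) - ∫ t in (0 : ℝ)..y, f t :=
    funext fun y => integral_Ioi_sub hf 0 y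
  rw [this]
  simpa using h.const_sub (∫ t in Ioi (0 : ℝ), f t)

theorem tendsto_integral_Ioi_atBot (hf : Integrable f) :
    Tendsto (fun x => ∫ t in Ioi x, f t) atBot (𝓝 (∫ t, f t)) := by
  have h := intervalIntegral_tendsto_integral_Iic 0 hf.integrableOn tendsto_id
  have : (fun x => ∫ t in Ioi x, f t) = fun y =>
      (∫ t in Ioi (0 : ℝ), f t) + ∫ t in y..(0 : ℝ), f t :=
    funext fun y => by rw [integral_Ioi_sub hf 0 y, intervalIntegral.integral_symm y 0]; ring
  rw [this]
  have h2 := h.const_add (∫ t in Ioi (0 : ℝ), f t)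
  have h3 := intervalIntegral.integral_Iic_add_Ioi (b := (0 : ℝ)) hf.integrableOn hf.integrableOn
  rw [add_comm, h3] at h2
  exact h2

end Tail

/-- A function vanishing continuously outside an open interval and at infinity has a derivative
of integral zero. -/
theorem integral_eq_zero_of_hasDerivAt_ordConnected {J : Set ℝ} (hJ : IsOpen J)
    (hJc : J.OrdConnected) {u u' : ℝ → ℝ} (hu : Continuous u) (hu0 : ∀ x ∉ J, u x = 0)
    (hu1 : ∀ x ∈ J, HasDerivAt u (u' x) x) (hu' : Integrable (J.indicator u'))
    (htop : Tendsto u atTop (𝓝 0)) (hbot : Tendsto u atBot (𝓝 0)) :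
    ∫ x, J.indicator u' x = 0 := by
  have key : ∀ n : ℕ, ∫ x in (-(n : ℝ))..n, J.indicator u' x = u n - u (-n) := by
    intro n
    -- The fundamental theorem of calculus tolerates countably many exceptional points. Here they
    -- are the frontier of an interval, which has at most one lower and one upper end point.
    have hfr : (frontier J).Countable := by
      have : (frontier J) ⊆ lowerBounds J ∪ upperBounds J := by
        intro x hx
        by_contra! hcon
        simp only [mem_union, not_or, mem_lowerBounds, mem_upperBounds, not_forall,
          not_le] at hcon
        obtain ⟨⟨a, ha, hax⟩, ⟨b, hb, hbx⟩⟩ := hcon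
        rw [hJ.frontier_eq] at hx
        exact hx.2 (hJc.out ha hb ⟨hax.le, hbx.le⟩)
      refine Countable.mono (s₂ := frontier J ∩ lowerBounds J ∪ frontier J ∩ upperBounds J)
        (fun x hx => (this hx).imp (fun h => ⟨hx, h⟩) (fun h => ⟨hx, h⟩)) ?_
      refine Countable.union (Set.Subsingleton.countable ?_) (Set.Subsingleton.countable ?_)
      · rintro x ⟨hx, hxl⟩ y ⟨hy, hyl⟩
        have h1 := (lowerBounds_closure (s := J)) ▸ hxl
        have h2 := (lowerBounds_closure (s := J)) ▸ hyl
        exact le_antisymm (h1 (frontier_subset_closure hy)) (h2 (frontier_subset_closure hx))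
      · rintro x ⟨hx, hxl⟩ y ⟨hy, hyl⟩
        have h1 := (upperBounds_closure (s := J)) ▸ hxl
        have h2 := (upperBounds_closure (s := J)) ▸ hyl
        exact le_antisymm (h2 (frontier_subset_closure hx)) (h1 (frontier_subset_closure hy))
    refine integral_eq_of_hasDerivAt_off_countable u _ hfr hu.continuousOn ?_
      hu'.intervalIntegrable
    rintro x ⟨-, hx⟩
    by_cases hxJ : x ∈ J
    · simpa [hxJ] using hu1 x hxJ
    · have : x ∈ (closure J)ᶜ := fun h => hx (hJ.frontier_eq ▸ ⟨h, hxJ⟩)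
      have hev : u =ᶠ[𝓝 x] fun _ => 0 := by
        filter_upwards [isClosed_closure.isOpen_compl.mem_nhds this] with y hy
        exact hu0 y fun h => hy (subset_closure h)
      simpa [hxJ] using (hasDerivAt_const x (0 : ℝ)).congr_of_eventuallyEq hev
  have h1 := intervalIntegral_tendsto_integral hu'
    (tendsto_neg_atTop_atBot.comp (tendsto_natCast_atTop_atTop (R := ℝ)))
    (tendsto_natCast_atTop_atTop (R := ℝ))
  have h2 : Tendsto (fun n : ℕ => u n - u (-n)) atTop (𝓝 (0 - 0)) :=
    (htop.comp (tendsto_natCast_atTop_atTop (R := ℝ))).sub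
      (hbot.comp (tendsto_neg_atTop_atBot.comp (tendsto_natCast_atTop_atTop (R := ℝ))))
  simp only [Function.comp_apply, key] at h1
  simpa using tendsto_nhds_unique h1 h2

/-- With `h = p τ`, the tail integral of `y p(y)`, one has `h' = -x p`, so integrating `(h G)'` over
`J` gives the formula. Since the mean is zero, `h` vanishes on both sides of `J`, and boundedness of
`G` then kills the boundary terms even if `G` has no limit at the end points. The kernel is cut off
outside `J`, which carries `μ`. -/
theorem IsIntervalDensity.isSteinKernel {μ : Measure ℝ} [IsProbabilityMeasure μ] {p : ℝ → ℝ}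
    (hp : IsIntervalDensity μ p) (hint : Integrable id μ) (hmean : ∫ x, x ∂μ = 0) :
    ∃ (J : Set ℝ), IsSteinKernel μ J (J.indicator (steinKernel p)) (deriv (steinKernel p)) := by
  obtain ⟨J, hJ, hJc, h0, h1⟩ := hp.exists_isOpen
  have hpm := hp.aemeasurable
  set f : ℝ → ℝ := fun y => y * p y with hf
  have hfint : Integrable f := by
    have := (hp.integrable_iff id).1 hint
    simpa [hf, mul_comm] using this
  have hm0 : ∫ z, z * p z = 0 := by
    rw [← hmean, hp.integral_eq]; simp only [mul_comm]
  set h : ℝ → ℝ := fun x => ∫ t in Ioi x, f t with hh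
  have hτ : steinKernel p = fun x => h x / p x := by
    funext x; simp only [steinKernel, hm0, sub_zero, hh, hf]
  have hτJ : ∀ x ∈ J, p x * steinKernel p x = h x := by
    intro x hx
    have := (h1 x hx).1.ne'
    rw [hτ]; field_simp
  have hderiv : ∀ x ∈ J, HasDerivAt h (-f x) x := by
    intro x hx
    exact hasDerivAt_integral_Ioi hfint (continuousAt_id.mul (h1 x hx).2.continuousAt)
      hfint.1.stronglyMeasurableAtFilter
  have hτd : ∀ x ∈ J, DifferentiableAt ℝ (steinKernel p) x := by
    intro x hx
    rw [hτ]
    exact (hderiv x hx).differentiableAt.div (h1 x hx).2 (h1 x hx).1.ne'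
  have hh0 : ∀ x ∉ J, h x = 0 := by
    intro x hx
    -- An interval missing `x` lies on one side of it, so the tail integral is either the whole mean
    -- or an integral of zero.
    by_cases hle : ∀ y ∈ J, x ≤ y
    · have e1 : h x = ∫ t, f t := by
        refine setIntegral_eq_integral_of_ae_compl_eq_zero ?_
        filter_upwards [h0] with y hy hyx
        have : y ∉ J := fun hyJ => hyx (lt_of_le_of_ne (hle y hyJ) (by rintro rfl; exact hx hyJ))
        simp [hf, hy this]
      rw [e1, hm0]
    · push Not at hle
      obtain ⟨y, hy, hyx⟩ := hle
      refine setIntegral_eq_zero_of_ae_eq_zero ?_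
      filter_upwards [h0] with z hz hzx
      have : z ∉ J := fun hzJ => hx (hJc.out hy hzJ ⟨hyx.le, (le_of_lt hzx)⟩)
      simp [hf, hz this]
  have hμJ : ∀ᵐ x ∂μ, x ∈ J := by
    rw [hp.law, ae_withDensity_iff' hpm.ennreal_ofReal]
    filter_upwards [h0] with x hx hne
    by_contra hxJ
    simp [hx hxJ] at hne
  refine ⟨J, hJ.measurableSet, hμJ, ?_, measurable_deriv _, ?_, ?_⟩
  · classical
    rw [← piecewise_eq_indicator]
    exact ContinuousOn.measurable_piecewise
      (fun x hx => (hτd x hx).continuousAt.continuousWithinAt) continuousOn_const hJ.measurableSet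
  · intro x hx
    refine (hτd x hx).hasDerivAt.congr_of_eventuallyEq ?_
    filter_upwards [hJ.mem_nhds hx] with y hy
    simp [hy]
  · intro G G' C hG hC hGi
    classical
    have hCx : ∀ x, |J.indicator (fun x => h x * G x) x| ≤ C * |h x| := by
      intro x
      by_cases hx : x ∈ J
      · simp only [hx, indicator_of_mem, abs_mul]
        rw [mul_comm]
        exact mul_le_mul_of_nonneg_right (hC x hx) (abs_nonneg _)
      · simp [hx, hh0 x hx]
    have hhc : Continuous h := continuous_integral_Ioi hfint
    -- Serves twice: for the limits at `±∞`, and for continuity of the cut-off product at points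
    -- outside `J`.
    have hsq : ∀ l : Filter ℝ, Tendsto h l (𝓝 0) →
        Tendsto (J.indicator (fun x => h x * G x)) l (𝓝 0) := by
      intro l hl
      refine squeeze_zero_norm (fun x => hCx x) ?_
      simpa using (hl.abs.const_mul C)
    have hGiJ : Integrable (J.indicator fun x => h x * G' x) := by
      refine ((hp.integrable_iff _).1 hGi).congr ?_
      filter_upwards [h0] with x hx
      by_cases hxJ : x ∈ J
      · simp only [hxJ, indicator_of_mem, ← hτJ x hxJ]; ring
      · simp [hxJ]
    have hGm : Measurable (J.indicator G) := by
      rw [← piecewise_eq_indicator]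
      exact ContinuousOn.measurable_piecewise
        (fun x hx => (hG x hx).continuousAt.continuousWithinAt) continuousOn_const hJ.measurableSet
    have hfG : Integrable (J.indicator fun x => f x * G x) := by
      have : (J.indicator fun x => f x * G x) = fun x => f x * J.indicator G x := by
        funext x; by_cases hx : x ∈ J <;> simp [hx]
      rw [this]
      refine hfint.mul_bdd (c := max C 0) hGm.aestronglyMeasurable (ae_of_all _ fun x => ?_)
      by_cases hx : x ∈ J
      · simp only [hx, indicator_of_mem, Real.norm_eq_abs]; exact (hC x hx).trans (le_max_left _ _)
      · simp [hx]
    have hsum : (J.indicator fun x => -f x * G x + h x * G' x) =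
        fun x => -(J.indicator (fun x => f x * G x) x) + J.indicator (fun x => h x * G' x) x := by
      funext x; by_cases hx : x ∈ J <;> simp [hx]
    have hzero := integral_eq_zero_of_hasDerivAt_ordConnected hJ hJc
      (u := J.indicator (fun x => h x * G x)) (u' := fun x => -f x * G x + h x * G' x) ?_
      (fun x hx => by simp [hx]) ?_ ?_ (hsq _ (tendsto_integral_Ioi_atTop hfint))
      (hsq _ (by have := tendsto_integral_Ioi_atBot hfint; rwa [hm0] at this))
    · have hz : -(∫ x, J.indicator (fun x => f x * G x) x) +
          ∫ x, J.indicator (fun x => h x * G' x) x = 0 := by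
        rw [hsum] at hzero
        rw [← hzero, ← integral_neg]
        exact (integral_add hfG.neg hGiJ).symm
      rw [hp.integral_eq, hp.integral_eq]
      have e1 : ∫ x, p x * (x * G x) = ∫ x, J.indicator (fun x => f x * G x) x := by
        refine integral_congr_ae ?_
        filter_upwards [h0] with x hx
        by_cases hxJ : x ∈ J
        · simp [hxJ, hf]; ring
        · simp [hxJ, hx]
      have e2 : ∫ x, p x * (J.indicator (steinKernel p) x * G' x) =
          ∫ x, J.indicator (fun x => h x * G' x) x := by
        refine integral_congr_ae (ae_of_all _ fun x => ?_)
        by_cases hxJ : x ∈ J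
        · simp only [hxJ, indicator_of_mem, ← hτJ x hxJ]; ring
        · simp [hxJ]
      rw [e1, e2]; linarith
    · refine continuous_iff_continuousAt.2 fun x => ?_
      by_cases hx : x ∈ J
      · refine ((hderiv x hx).mul (hG x hx)).continuousAt.congr ?_
        filter_upwards [hJ.mem_nhds hx] with y hy
        simp [hy]
      · have := hsq (𝓝 x) (by simpa [hh0 x hx] using hhc.tendsto x)
        simpa [ContinuousAt, hx] using this
    · intro x hx
      refine ((hderiv x hx).mul (hG x hx)).congr_of_eventuallyEq ?_
      filter_upwards [hJ.mem_nhds hx] with y hy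
      simp [hy]
    · rw [hsum]; exact hfG.neg.add hGiJ

/-! ### From an integration by parts formula to a density and its score. -/

theorem integral_integral_Iio_mul {μ : Measure ℝ} [SFinite μ] {ψ w : ℝ → ℝ}
    (hψ : Integrable ψ) (hw : Integrable w μ) :
    ∫ x, (∫ t in Iio x, ψ t) * w x ∂μ = ∫ t, ψ t * ∫ x in Ioi t, w x ∂μ := by
  have hS : MeasurableSet {z : ℝ × ℝ | z.2 < z.1} := measurableSet_lt measurable_snd measurable_fst
  have hint : Integrable ({z : ℝ × ℝ | z.2 < z.1}.indicator fun z => w z.1 * ψ z.2)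
      (μ.prod volume) := (hw.mul_prod hψ).indicator hS
  have hsw := integral_integral_swap (f := fun x t =>
    {z : ℝ × ℝ | z.2 < z.1}.indicator (fun z => w z.1 * ψ z.2) (x, t)) hint
  have e1 : ∀ x, ∫ t, {z : ℝ × ℝ | z.2 < z.1}.indicator (fun z => w z.1 * ψ z.2) (x, t) =
      (∫ t in Iio x, ψ t) * w x := by
    intro x
    rw [mul_comm, ← integral_const_mul, ← integral_indicator measurableSet_Iio]
    rfl
  have e2 : ∀ t, ∫ x, {z : ℝ × ℝ | z.2 < z.1}.indicator (fun z => w z.1 * ψ z.2) (x, t) ∂μ =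
      ψ t * ∫ x in Ioi t, w x ∂μ := by
    intro t
    rw [mul_comm, ← integral_mul_const, ← integral_indicator measurableSet_Ioi]
    rfl
  simpa only [e1, e2] using hsw

/-- A probability law satisfying an integration by parts formula with integrable weight `w` has the
density `t ↦ ∫_t^∞ w dμ`. -/
theorem exists_isACDensity {μ : Measure ℝ} [IsProbabilityMeasure μ] {w : ℝ → ℝ}
    (hw : Integrable w μ)
    (hibp : ∀ (φ ψ : ℝ → ℝ) (C : ℝ), (∀ x, HasDerivAt φ (ψ x) x) → Continuous ψ →
      (∀ x, |φ x| ≤ C) → (∀ x, |ψ x| ≤ C) → ∫ x, ψ x ∂μ = ∫ x, φ x * w x ∂μ) :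
    ∃ q : ℝ → ℝ, IsACDensity μ q fun x => -(w x * q x) := by
  set q : ℝ → ℝ := fun t => ∫ x in Ioi t, w x ∂μ with hq
  -- The sign of `q` is not known beforehand. It is split as `qp - qm`, and the claim becomes the
  -- identity `μ + qm dx = qp dx` between positive locally finite measures, which can be tested on
  -- compactly supported functions.
  set qp : ℝ → ℝ := fun t => ∫ x in Ioi t, max (w x) 0 ∂μ with hqp
  set qm : ℝ → ℝ := fun t => ∫ x in Ioi t, max (-w x) 0 ∂μ with hqm
  have hwp : Integrable (fun x => max (w x) 0) μ := hw.pos_part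
  have hwm : Integrable (fun x => max (-w x) 0) μ := hw.neg_part
  have hqeq : ∀ t, q t = qp t - qm t := by
    intro t
    rw [hq, hqp, hqm]; dsimp only
    rw [← integral_sub hwp.integrableOn hwm.integrableOn]
    refine integral_congr_ae (ae_of_all _ fun x => ?_)
    rcases le_total 0 (w x) with h | h <;> simp [h]
  have hanti : ∀ g : ℝ → ℝ, Integrable g μ → (∀ x, 0 ≤ g x) →
      Antitone (fun t => ∫ x in Ioi t, g x ∂μ) ∧ ∀ t, 0 ≤ (∫ x in Ioi t, g x ∂μ) ∧
        (∫ x in Ioi t, g x ∂μ) ≤ ∫ x, g x ∂μ := by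
    intro g hg hg0
    refine ⟨fun s t hst => setIntegral_mono_set hg.integrableOn (ae_of_all _ hg0)
      (Ioi_subset_Ioi hst).eventuallyLE, fun t => ⟨integral_nonneg hg0,
      setIntegral_le_integral hg (ae_of_all _ hg0)⟩⟩
  obtain ⟨hpa, hpb⟩ := hanti _ hwp fun x => le_max_right _ _
  obtain ⟨hma, hmb⟩ := hanti _ hwm fun x => le_max_right _ _
  have hpm : Measurable qp := hpa.measurable
  have hmm : Measurable qm := hma.measurable
  have hlf : ∀ (g : ℝ → ℝ) (C : ℝ), (∀ t, g t ≤ C) →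
      IsLocallyFiniteMeasure (volume.withDensity fun t => ENNReal.ofReal (g t)) := by
    intro g C hg
    refine ⟨fun x => ⟨Metric.ball x 1, Metric.ball_mem_nhds x one_pos, ?_⟩⟩
    rw [withDensity_apply _ Metric.isOpen_ball.measurableSet]
    calc ∫⁻ t in Metric.ball x 1, ENNReal.ofReal (g t)
        ≤ ∫⁻ t in Metric.ball x 1, ENNReal.ofReal C :=
          lintegral_mono fun t => ENNReal.ofReal_le_ofReal (hg t)
      _ < ∞ := by
          rw [setLIntegral_const]
          exact ENNReal.mul_lt_top ENNReal.ofReal_lt_top measure_ball_lt_top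
  have := hlf qp _ fun t => (hpb t).2
  have hqmlf := hlf qm _ fun t => (hmb t).2
  have : IsLocallyFiniteMeasure (μ + volume.withDensity fun t => ENNReal.ofReal (qm t)) := by
    refine ⟨fun x => ?_⟩
    obtain ⟨s, hs, hfin⟩ := hqmlf.finiteAtNhds x
    exact ⟨s, hs, by rw [Measure.add_apply]; exact ENNReal.add_lt_top.2 ⟨measure_lt_top _ _, hfin⟩⟩
  have hbd : ∀ (g : ℝ → ℝ) (C : ℝ), Measurable g → (∀ t, 0 ≤ g t ∧ g t ≤ C) → ∀ ψ : ℝ → ℝ,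
      Integrable ψ → Integrable (fun t => ψ t * g t) := by
    intro g C hg hC ψ hψ
    exact hψ.mul_bdd (c := C) hg.aestronglyMeasurable
      (ae_of_all _ fun t => by rw [Real.norm_of_nonneg (hC t).1]; exact (hC t).2)
  have hwd : ∀ (g : ℝ → ℝ), Measurable g → (∀ t, 0 ≤ g t) → ∀ ψ : ℝ → ℝ,
      ∫ t, ψ t ∂(volume.withDensity fun t => ENNReal.ofReal (g t)) = ∫ t, ψ t * g t := by
    intro g hg hg0 ψ
    rw [integral_withDensity_eq_integral_toReal_smul hg.ennreal_ofReal (by simp)]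
    refine integral_congr_ae (ae_of_all _ fun t => ?_)
    simp only [ENNReal.toReal_ofReal (hg0 t), smul_eq_mul, mul_comm]
  have hadd : μ + volume.withDensity (fun t => ENNReal.ofReal (qm t)) =
      volume.withDensity (fun t => ENNReal.ofReal (qp t)) := by
    refine Measure.ext_of_integral_eq_on_compactlySupported fun ψ => ?_
    have hψc : Continuous ψ := ψ.continuous
    have hψi : Integrable ψ := hψc.integrable_of_hasCompactSupport ψ.hasCompactSupport
    obtain ⟨C, hC⟩ := hψc.bounded_above_of_compact_support ψ.hasCompactSupport
    -- The test function is the primitive of `ψ` vanishing at `-∞`; Fubini then turns `∫ φ w dμ`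
    -- into `∫ ψ q dt`.
    have hφ : ∀ x, HasDerivAt (fun x => ∫ t in Iio x, ψ t) (ψ x) x := by
      intro x
      have h2 := (hasDerivAt_integral_Ioi hψi hψc.continuousAt (x := x)
        (hψc.stronglyMeasurableAtFilter _ _)).const_sub (∫ t, ψ t)
      rw [neg_neg] at h2
      refine h2.congr_of_eventuallyEq (Eventually.of_forall fun y => ?_)
      have := intervalIntegral.integral_Iic_add_Ioi (b := y) (f := ψ) (μ := volume)
        hψi.integrableOn hψi.integrableOn
      simp only [← integral_Iic_eq_integral_Iio]
      linarith
    have h1 := hibp _ _ (max C (∫ t, |ψ t|)) hφ hψc (fun x => by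
        refine le_max_of_le_right ((abs_integral_le_integral_abs).trans ?_)
        exact setIntegral_le_integral hψi.abs (ae_of_all _ fun _ => abs_nonneg _))
        (fun x => le_max_of_le_left (hC x))
    rw [integral_integral_Iio_mul hψi hw] at h1
    have hψμ : Integrable ψ μ := Integrable.of_bound hψc.aestronglyMeasurable C (ae_of_all _ hC)
    have hψm : Integrable ψ (volume.withDensity fun t => ENNReal.ofReal (qm t)) :=
      hψc.integrable_of_hasCompactSupport ψ.hasCompactSupport
    rw [integral_add_measure hψμ hψm, h1, hwd qm hmm fun t => (hmb t).1,
      hwd qp hpm fun t => (hpb t).1,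
      ← integral_add _ (hbd qm _ hmm hmb ψ hψi)]
    · refine integral_congr_ae (ae_of_all _ fun t => ?_)
      have := hqeq t
      simp only [hq] at this
      simp only [this]; ring
    · have : (fun t => ψ t * ∫ x in Ioi t, w x ∂μ) = fun t => ψ t * qp t - ψ t * qm t := by
        funext t
        have := hqeq t
        simp only [hq] at this
        rw [this]; ring
      rw [this]
      exact (hbd qp _ hpm hpb ψ hψi).sub (hbd qm _ hmm hmb ψ hψi)
  -- Dropping `μ` from the identity leaves an inequality of measures, hence of densities.
  have hle : ∀ᵐ t, qm t ≤ qp t := by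
    have : (fun t => ENNReal.ofReal (qm t)) ≤ᵐ[volume] fun t => ENNReal.ofReal (qp t) := by
      refine ae_le_of_forall_setLIntegral_le_of_sigmaFinite hmm.ennreal_ofReal ?_
      intro s hs _
      rw [← withDensity_apply _ hs, ← withDensity_apply _ hs, ← hadd]
      simp
    filter_upwards [this] with t ht
    exact (ENNReal.ofReal_le_ofReal_iff (hpb t).1).1 ht
  have hqm' : Measurable q := by
    have : q = fun t => qp t - qm t := funext hqeq
    rw [this]; exact hpm.sub hmm
  have hq0 : ∀ᵐ t, 0 ≤ q t := by
    filter_upwards [hle] with t ht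
    rw [hqeq]; linarith
  have hlaw : μ = volume.withDensity fun t => ENNReal.ofReal (q t) := by
    have h2 : volume.withDensity (fun t => ENNReal.ofReal (qp t)) =
        volume.withDensity (fun t => ENNReal.ofReal (q t)) +
          volume.withDensity (fun t => ENNReal.ofReal (qm t)) := by
      rw [← withDensity_add_left hqm'.ennreal_ofReal]
      refine withDensity_congr_ae ?_
      filter_upwards [hq0] with t ht
      simp only [Pi.add_apply]
      rw [← ENNReal.ofReal_add ht (hmb t).1, hqeq]; congr 1; ring
    rw [h2] at hadd
    exact Measure.add_left_inj _ _ _ |>.1 hadd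
  have hqw : Integrable fun x => w x * q x := by
    have := hw
    rw [hlaw, integrable_withDensity_iff_integrable_smul' hqm'.ennreal_ofReal (by simp)] at this
    refine this.congr ?_
    filter_upwards [hq0] with t ht
    rw [ENNReal.toReal_ofReal ht, smul_eq_mul, mul_comm]
  -- Substituting `μ = q dx` into the definition of `q` gives an integral equation, the source of
  -- both continuity and `q' = -w q`.
  have hqt : ∀ t, q t = ∫ x in Ioi t, w x * q x := by
    intro t
    have : q t = ∫ x in Ioi t, w x ∂(volume.withDensity fun t => ENNReal.ofReal (q t)) := by
      rw [← hlaw]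
    rw [this, setIntegral_withDensity_eq_setIntegral_toReal_smul hqm'.ennreal_ofReal (by simp) _
      measurableSet_Ioi]
    refine integral_congr_ae (ae_restrict_of_ae ?_)
    filter_upwards [hq0] with t ht
    rw [ENNReal.toReal_ofReal ht, smul_eq_mul, mul_comm]
  have hqc : Continuous q := by
    have : q = fun t => ∫ x in Ioi t, w x * q x := funext hqt
    rw [this]; exact continuous_integral_Ioi hqw
  refine ⟨q, hlaw, fun x => ?_, hqw.neg.locallyIntegrable, fun x y => ?_⟩
  -- Nonnegativity almost everywhere becomes nonnegativity everywhere: by continuity `{q < 0}` is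
  -- open, and it is null.
  · by_contra hx
    have ho : IsOpen {t | q t < 0} := isOpen_lt hqc continuous_const
    have hz : volume {t | q t < 0} = 0 := by
      rw [ae_iff] at hq0
      simpa using hq0
    have := (ho.measure_eq_zero_iff volume).1 hz
    exact (this ▸ (show x ∈ {t | q t < 0} from not_le.1 hx) : x ∈ (∅ : Set ℝ))
  · rw [intervalIntegral.integral_neg, hqt y, integral_Ioi_sub hqw x y, ← hqt x]; ring

/-- As `φ(F)` is `F`-measurable, `W` may be replaced by `w(F) = E[W | F]` in the formula. The score
at `F` is then `-w(F)`, so the integrand is the square of the conditional expectation of `(F - E F)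
/ Var F - W` given `F`, and conditional expectation contracts `L²`. -/
theorem fisherDist_le_of_comap_eq {Ω : Type*} {m : MeasurableSpace Ω} {mΩ : MeasurableSpace Ω}
    {P : Measure Ω} [IsProbabilityMeasure P] {F W : Ω → ℝ}
    (hm : MeasurableSpace.comap F inferInstance = m) (hF : Measurable F) (hFi : Integrable F P)
    (hW : Integrable W P)
    (hibp : ∀ (φ ψ : ℝ → ℝ) (C : ℝ), (∀ x, HasDerivAt φ (ψ x) x) → Continuous ψ →
      (∀ x, |φ x| ≤ C) → (∀ x, |ψ x| ≤ C) → ∫ ω, ψ (F ω) ∂P = ∫ ω, φ (F ω) * W ω ∂P) :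
    fisherDist P F ≤ eLpNorm (fun ω => (F ω - P[F]) / Var[F; P] - W ω) 2 P ^ 2 := by
  have hmle : m ≤ mΩ := hm ▸ hF.comap_le
  have hFm : Measurable[m] F := hm ▸ comap_measurable F
  obtain ⟨w, hwm, hwF⟩ := (stronglyMeasurable_condExp (m := m) (μ := P) (f := W)).measurable.mono
    hm.ge le_rfl |>.exists_eq_measurable_comp
  have hwi : Integrable w (P.map F) := by
    rw [integrable_map_measure hwm.aestronglyMeasurable hF.aemeasurable, ← hwF]
    exact integrable_condExp
  have := Measure.isProbabilityMeasure_map (μ := P) hF.aemeasurable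
  obtain ⟨q, hq⟩ := exists_isACDensity hwi (by
    intro φ ψ C hφ hψ hφC hψC
    have hφc : Continuous φ := continuous_iff_continuousAt.2 fun x => (hφ x).continuousAt
    rw [integral_map hF.aemeasurable hψ.aestronglyMeasurable,
      integral_map (f := fun x => φ x * w x) hF.aemeasurable
        (hφc.measurable.mul hwm).aestronglyMeasurable,
      hibp φ ψ C hφ hψ hφC hψC]
    have hmeas : StronglyMeasurable[m] (fun ω => φ (F ω)) :=
      (hφc.measurable.comp hFm).stronglyMeasurable
    have hint : Integrable ((fun ω => φ (F ω)) * W) P :=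
      hW.bdd_mul (c := C) (hφc.measurable.comp hF).aestronglyMeasurable (ae_of_all _ fun ω => hφC _)
    have h1 := condExp_mul_of_aestronglyMeasurable_left (m := m) hmeas.aestronglyMeasurable hint hW
    have h2 := integral_condExp hmle (f := (fun ω => φ (F ω)) * W) (μ := P)
    calc _ = ∫ ω, ((fun ω => φ (F ω)) * W) ω ∂P := rfl
      _ = _ := by
        rw [← h2]
        refine integral_congr_ae ?_
        filter_upwards [h1] with ω hω
        rw [hω, Pi.mul_apply, hwF]; rfl)
  have hle : fisherDist P F ≤
      ∫⁻ ω, ‖-(w (F ω) * q (F ω)) / q (F ω) + (F ω - P[F]) / Var[F; P]‖ₑ ^ 2 ∂P :=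
    iInf_le_of_le q (iInf_le_of_le (fun x => -(w x * q x)) (iInf_le_of_le hq le_rfl))
  refine hle.trans ?_
  -- The quotient `q' / q` equals `-w` only where `q ≠ 0`; this holds almost surely at `F`, since
  -- `q` is its density.
  have hne : ∀ᵐ ω ∂P, q (F ω) ≠ 0 := by
    refine ae_of_ae_map hF.aemeasurable (p := fun x => q x ≠ 0) ?_
    have hqm : Measurable q := by
      have : q = fun y => q 0 + ∫ t in (0 : ℝ)..y, -(w t * q t) := by
        funext y; rw [← hq.integral_eq]; ring
      rw [this]
      exact (continuous_const.add (intervalIntegral.continuous_primitive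
        (fun a b => (hq.locallyIntegrable.integrableOn_isCompact
          isCompact_uIcc).intervalIntegrable) 0)).measurable
    rw [hq.law, ae_withDensity_iff hqm.ennreal_ofReal]
    refine ae_of_all _ fun x hx h0 => hx (by simp [h0])
  have hG : Integrable (fun ω => (F ω - P[F]) / Var[F; P]) P :=
    (hFi.sub (integrable_const _)).div_const _
  have hce : (fun ω => -(w (F ω) * q (F ω)) / q (F ω) + (F ω - P[F]) / Var[F; P]) =ᵐ[P]
      P[fun ω => (F ω - P[F]) / Var[F; P] - W ω | m] := by
    have h1 := condExp_sub hG hW m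
    have h3 : P[fun ω => (F ω - P[F]) / Var[F; P] | m] = fun ω => (F ω - P[F]) / Var[F; P] :=
      condExp_of_stronglyMeasurable hmle
        ((hFm.sub_const _).div_const _).stronglyMeasurable hG
    filter_upwards [h1, hne] with ω hω hqω
    have h4 : (P[fun ω => (F ω - P[F]) / Var[F; P] - W ω | m]) ω = (F ω - P[F]) / Var[F; P] -
        w (F ω) := by
      refine Eq.trans hω ?_
      rw [Pi.sub_apply, h3, hwF]; rfl
    rw [h4]
    field_simp
    ring
  have h5 := eLpNorm_condExp_le_eLpNorm (m := m) (μ := P)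
    (fun ω => (F ω - P[F]) / Var[F; P] - W ω) (p := 2) one_le_two
  rw [← eLpNorm_congr_ae hce] at h5
  refine le_trans (le_of_eq ?_) (pow_le_pow_left' h5 2)
  rw [eLpNorm_eq_lintegral_rpow_enorm_toReal two_ne_zero (by simp)]
  simp only [ENNReal.toReal_ofNat, ENNReal.rpow_ofNat]
  rw [← ENNReal.rpow_natCast, ← ENNReal.rpow_mul]
  norm_num

/-- The Fisher information distance is controlled by the weight in an integration by parts
formula. -/
theorem fisherDist_le_eLpNorm {Ω : Type*} [MeasurableSpace Ω] {P : Measure Ω}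
    [IsProbabilityMeasure P] {F W : Ω → ℝ} (hF : Measurable F) (hFi : Integrable F P)
    (hW : Integrable W P)
    (hibp : ∀ (φ ψ : ℝ → ℝ) (C : ℝ), (∀ x, HasDerivAt φ (ψ x) x) → Continuous ψ →
      (∀ x, |φ x| ≤ C) → (∀ x, |ψ x| ≤ C) → ∫ ω, ψ (F ω) ∂P = ∫ ω, φ (F ω) * W ω ∂P) :
    fisherDist P F ≤ eLpNorm (fun ω => (F ω - P[F]) / Var[F; P] - W ω) 2 P ^ 2 :=
  fisherDist_le_of_comap_eq rfl hF hFi hW hibp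

/-! ### Eighth moments of sums of independent centred variables. -/

/-- The binomial terms of degree at least two in `y` are absorbed by arithmetic-geometric mean
inequalities. The coefficient `242` is not sharp: its double is `484 = 22 ^ 2`, whose fourth power
has an exact eighth root. -/
theorem add_pow_eight_le (s y : ℝ) :
    (s + y) ^ 8 ≤ s ^ 8 + 8 * (s ^ 7 * y) + 242 * (s ^ 6 * y ^ 2 + y ^ 8) := by
  have h1 : 0 ≤ s ^ 4 * y ^ 2 * (s - y) ^ 2 := by positivity
  have h2 : 0 ≤ s ^ 2 * y ^ 4 * (s - y) ^ 2 := by positivity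
  have h3 : 0 ≤ y ^ 6 * (s - y) ^ 2 := by positivity
  have h4 : 0 ≤ y ^ 2 * (s ^ 2 + y ^ 2) * (s ^ 2 - y ^ 2) ^ 2 := by positivity
  have h5 : 0 ≤ s ^ 6 * y ^ 2 := by positivity
  have h6 : 0 ≤ y ^ 8 := by positivity
  have h7 : 0 ≤ y ^ 4 * (s ^ 2 - y ^ 2) ^ 2 := by positivity
  have h8 : 0 ≤ s ^ 2 * y ^ 2 * (s ^ 2 - y ^ 2) ^ 2 := by positivity
  linarith

/-- The threshold `a` will be of order `n`, the size of the square of a sum of `n` terms, so that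
both terms on the right are of order `n ^ 3`. -/
theorem pow_six_le_div_add {s a : ℝ} (ha : 0 < a) : s ^ 6 ≤ s ^ 8 / a + a ^ 3 := by
  rcases le_total (s ^ 2) a with h | h
  · have h1 : s ^ 6 ≤ a ^ 3 := by
      calc s ^ 6 = (s ^ 2) ^ 3 := by ring
        _ ≤ a ^ 3 := by gcongr
    have : 0 ≤ s ^ 8 / a := by positivity
    linarith
  · have h1 : s ^ 6 ≤ s ^ 8 / a := by
      rw [le_div_iff₀ ha]
      calc s ^ 6 * a ≤ s ^ 6 * s ^ 2 := by gcongr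
        _ = s ^ 8 := by ring
    have : 0 ≤ a ^ 3 := by positivity
    linarith

theorem integrable_pow_of_memLp {Ω : Type*} [MeasurableSpace Ω] {P : Measure Ω}
    [IsFiniteMeasure P] {f : Ω → ℝ} {m : ℕ} (hf : MemLp f m P) {j : ℕ} (hj : j ≤ m) :
    Integrable (fun ω => f ω ^ j) P := by
  rcases eq_or_ne j 0 with rfl | h0
  · simp
  · have h1 := (hf.mono_exponent (p := (j : ℝ≥0∞)) (by exact_mod_cast hj)).integrable_norm_pow h0
    refine (integrable_norm_iff (hf.1.pow j)).1 (h1.congr (ae_of_all _ fun ω => ?_))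
    simp [norm_pow]

/-- Eighth moments of sums of independent centered random variables. -/
theorem integral_sum_range_pow_eight_le {Ω : Type*} [MeasurableSpace Ω] {P : Measure Ω}
    [IsProbabilityMeasure P] {Y : ℕ → Ω → ℝ} (hm : ∀ k, Measurable (Y k)) (hi : iIndepFun Y P)
    (h0 : ∀ k, P[Y k] = 0) (h8 : ∀ k, MemLp (Y k) 8 P) {B : ℝ} (hB : 1 ≤ B)
    (hYB : ∀ k, ∫ ω, Y k ω ^ 8 ∂P ≤ B) (n : ℕ) :
    ∫ ω, (∑ k ∈ Finset.range n, Y k ω) ^ 8 ∂P ≤ (484 * B) ^ 4 * n ^ 4 := by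
  have hS8 : ∀ n, MemLp (fun ω => ∑ k ∈ Finset.range n, Y k ω) ((8 : ℕ) : ℝ≥0∞) P := fun n =>
    memLp_finsetSum _ fun k _ => by exact_mod_cast h8 k
  have hY8 : ∀ k, MemLp (Y k) ((8 : ℕ) : ℝ≥0∞) P := fun k => by exact_mod_cast h8 k
  have hK : B ≤ (484 * B) ^ 4 := by
    calc B ≤ (484 * B) ^ 1 := by linarith
      _ ≤ (484 * B) ^ 4 := pow_le_pow_right₀ (by linarith) (by norm_num)
  have hY2 : ∀ k, ∫ ω, Y k ω ^ 2 ∂P ≤ 2 * B := by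
    intro k
    calc ∫ ω, Y k ω ^ 2 ∂P ≤ ∫ ω, (1 + Y k ω ^ 8) ∂P := by
          refine integral_mono (integrable_pow_of_memLp (hY8 k) (by norm_num))
            ((integrable_const _).add (integrable_pow_of_memLp (hY8 k) le_rfl)) fun ω => ?_
          dsimp only
          nlinarith [sq_nonneg (Y k ω ^ 2 - 1), sq_nonneg (Y k ω ^ 4 - 1), sq_nonneg (Y k ω)]
      _ = 1 + ∫ ω, Y k ω ^ 8 ∂P := by
          rw [integral_add (integrable_const _) (integrable_pow_of_memLp (hY8 k) le_rfl)]
          simp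
      _ ≤ 2 * B := by linarith [hYB k]
  induction n with
  | zero => simp
  | succ n ih =>
    -- The first summand is treated apart because the induction step divides by `n`.
    rcases Nat.eq_zero_or_pos n with rfl | hn
    · simpa using (hYB 0).trans hK
    set S : Ω → ℝ := fun ω => ∑ k ∈ Finset.range n, Y k ω with hS
    have hSY : IndepFun S (Y n) P := by
      have := hi.indepFun_finsetSum_of_notMem hm (s := Finset.range n) (i := n) (by simp)
      convert this using 1
      funext ω; simp [hS]
    have hSp : ∀ j ≤ 8, Integrable (fun ω => S ω ^ j) P := fun j hj =>
      integrable_pow_of_memLp (hS8 n) hj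
    have hYp : ∀ j ≤ 8, Integrable (fun ω => Y n ω ^ j) P := fun j hj =>
      integrable_pow_of_memLp (hY8 n) hj
    have hind : ∀ i j : ℕ, IndepFun (fun ω => S ω ^ i) (fun ω => Y n ω ^ j) P := fun i j =>
      hSY.comp (measurable_id.pow_const i) (measurable_id.pow_const j)
    have hi76 : ∀ i ≤ 8, ∀ j ≤ 8, Integrable (fun ω => S ω ^ i * Y n ω ^ j) P :=
      fun i hi' j hj => (hind i j).integrable_mul (hSp i hi') (hYp j hj)
    have hprod : ∀ i ≤ 8, ∀ j ≤ 8, ∫ ω, S ω ^ i * Y n ω ^ j ∂P =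
        (∫ ω, S ω ^ i ∂P) * ∫ ω, Y n ω ^ j ∂P := fun i hi' j hj =>
      (hind i j).integral_fun_mul_eq_mul_integral (hSp i hi').1 (hYp j hj).1
    have hn' : (0 : ℝ) < n := by exact_mod_cast hn
    -- Since `242 * E[Y²] ≤ 484 * B`, this threshold bounds the sixth moment term by `E[S⁸] / n +
    -- (484 * B) ^ 4 * n ^ 3`. By induction both parts are at most `(484 * B) ^ 4 * n ^ 3`, and the
    -- increment fits into `4 * n ^ 3 ≤ (n + 1) ^ 4 - n ^ 4`.
    have ha : 0 < 484 * B * n := by positivity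
    have h6 : ∫ ω, S ω ^ 6 ∂P ≤ (∫ ω, S ω ^ 8 ∂P) / (484 * B * n) + (484 * B * n) ^ 3 := by
      calc ∫ ω, S ω ^ 6 ∂P ≤ ∫ ω, (S ω ^ 8 / (484 * B * n) + (484 * B * n) ^ 3) ∂P :=
            integral_mono (hSp 6 (by norm_num))
              (((hSp 8 le_rfl).div_const _).add (integrable_const _))
              fun ω => pow_six_le_div_add ha
        _ = _ := by
            rw [integral_add ((hSp 8 le_rfl).div_const _) (integrable_const _), integral_div]
            simp
    -- The term linear in `Y n` vanishes by independence and centring.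
    have h70 := hprod 7 (by norm_num) 1 (by norm_num)
    simp only [pow_one, h0 n, mul_zero] at h70
    have h62 := hprod 6 (by norm_num) 2 (by norm_num)
    have hi71 := hi76 7 (by norm_num) 1 (by norm_num)
    simp only [pow_one] at hi71
    have hi62 := hi76 6 (by norm_num) 2 (by norm_num)
    have hstep : ∫ ω, (S ω + Y n ω) ^ 8 ∂P ≤ ∫ ω, S ω ^ 8 ∂P +
        242 * ((∫ ω, S ω ^ 6 ∂P) * (∫ ω, Y n ω ^ 2 ∂P) + ∫ ω, Y n ω ^ 8 ∂P) := by
      calc ∫ ω, (S ω + Y n ω) ^ 8 ∂P ≤ ∫ ω, (S ω ^ 8 + 8 * (S ω ^ 7 * Y n ω) +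
            242 * (S ω ^ 6 * Y n ω ^ 2 + Y n ω ^ 8)) ∂P := by
            refine integral_mono ?_ ?_ fun ω => add_pow_eight_le _ _
            · exact integrable_pow_of_memLp ((hS8 n).add (hY8 n)) le_rfl
            · exact ((hSp 8 le_rfl).add (hi71.const_mul 8)).add
                ((hi62.add (hYp 8 le_rfl)).const_mul 242)
        _ = _ := by
            have hA : Integrable (fun ω => S ω ^ 8 + 8 * (S ω ^ 7 * Y n ω)) P :=
              (hSp 8 le_rfl).add (hi71.const_mul 8)
            have hC : Integrable (fun ω => 242 * (S ω ^ 6 * Y n ω ^ 2 + Y n ω ^ 8)) P :=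
              (hi62.add (hYp 8 le_rfl)).const_mul 242
            rw [integral_add hA hC, integral_add (hSp 8 le_rfl)
              (hi71.const_mul 8), integral_const_mul, integral_const_mul,
              integral_add hi62 (hYp 8 le_rfl), h70, h62]
            ring
    simp only [Finset.sum_range_succ]
    refine hstep.trans ?_
    have hS6 : 0 ≤ ∫ ω, S ω ^ 6 ∂P := integral_nonneg fun ω => by positivity
    have hmul : (∫ ω, S ω ^ 6 ∂P) * (∫ ω, Y n ω ^ 2 ∂P) ≤
        ((∫ ω, S ω ^ 8 ∂P) / (484 * B * n) + (484 * B * n) ^ 3) * (2 * B) := by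
      refine (mul_le_mul_of_nonneg_left (hY2 n) hS6).trans ?_
      exact mul_le_mul_of_nonneg_right h6 (by linarith)
    have hdiv : ((∫ ω, S ω ^ 8 ∂P) / (484 * B * n) + (484 * B * n) ^ 3) * (2 * B) * 242 =
        (∫ ω, S ω ^ 8 ∂P) / n + (484 * B) ^ 4 * n ^ 3 := by
      field_simp
      ring
    have hdn : (∫ ω, S ω ^ 8 ∂P) / n ≤ (484 * B) ^ 4 * n ^ 3 := by
      rw [div_le_iff₀ hn']
      calc _ ≤ _ := ih
        _ = _ := by ring
    have hn1 : (1 : ℝ) ≤ n := by exact_mod_cast hn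
    have hn3 : (1 : ℝ) ≤ (n : ℝ) ^ 3 := one_le_pow₀ hn1
    have hB2 : 242 * B ≤ (484 * B) ^ 4 := by
      calc 242 * B ≤ (484 * B) ^ 1 := by linarith
        _ ≤ (484 * B) ^ 4 := pow_le_pow_right₀ (by linarith) (by norm_num)
    have hK0 : 0 ≤ (484 * B) ^ 4 := by positivity
    have hKn : (484 * B) ^ 4 ≤ (484 * B) ^ 4 * n ^ 3 := le_mul_of_one_le_right hK0 hn3
    have hexp : (484 * B) ^ 4 * (n : ℝ) ^ 4 + 4 * ((484 * B) ^ 4 * n ^ 3) ≤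
        (484 * B) ^ 4 * ((n + 1 : ℕ) : ℝ) ^ 4 := by
      push_cast
      have : (n : ℝ) ^ 4 + 4 * n ^ 3 ≤ (n + 1 : ℝ) ^ 4 := by nlinarith [sq_nonneg (n : ℝ)]
      nlinarith
    have := hYB n
    linarith

/-! ### Integration by parts for functions of `∑ X_k` and `∑ τ_k(X_k)`. -/

section Kernel

variable {Ω : Type*} [MeasurableSpace Ω] {P : Measure Ω} [IsProbabilityMeasure P]

/-- Integration by parts with respect to one of two independent random variables. -/
theorem IsSteinKernel.integral_mul_of_indepFun {E : Type*} [MeasurableSpace E] {X : Ω → ℝ}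
    {Z : Ω → E} {J : Set ℝ} {τ τ' : ℝ → ℝ} (hτ : IsSteinKernel (P.map X) J τ τ')
    (hX : Measurable X) (hZ : Measurable Z) (hXZ : IndepFun X Z P) (hXi : Integrable X P)
    {Φ Φ' : ℝ → E → ℝ} {C : ℝ} (hΦ : Measurable (Function.uncurry Φ))
    (hΦ' : Measurable (Function.uncurry Φ')) (hC : ∀ x z, |Φ x z| ≤ C)
    (hd : ∀ x ∈ J, ∀ z, HasDerivAt (fun x => Φ x z) (Φ' x z) x)
    (hi : Integrable (fun ω => τ (X ω) * Φ' (X ω) (Z ω)) P) :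
    ∫ ω, X ω * Φ (X ω) (Z ω) ∂P = ∫ ω, τ (X ω) * Φ' (X ω) (Z ω) ∂P := by
  have := Measure.isProbabilityMeasure_map (μ := P) hX.aemeasurable
  have := Measure.isProbabilityMeasure_map (μ := P) hZ.aemeasurable
  have hXZm := hX.prodMk hZ
  have hlaw := (indepFun_iff_map_prod_eq_prod_map_map hX.aemeasurable hZ.aemeasurable).1 hXZ
  have m1 : Measurable fun y : ℝ × E => y.1 * Φ y.1 y.2 := measurable_fst.mul hΦ
  have m2 : Measurable fun y : ℝ × E => τ y.1 * Φ' y.1 y.2 :=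
    (hτ.measurable.comp measurable_fst).mul hΦ'
  have i1 : Integrable (fun y : ℝ × E => y.1 * Φ y.1 y.2) ((P.map X).prod (P.map Z)) := by
    rw [← hlaw, integrable_map_measure m1.aestronglyMeasurable hXZm.aemeasurable]
    exact hXi.mul_bdd (c := C) (hΦ.comp hXZm).aestronglyMeasurable (ae_of_all _ fun ω => hC _ _)
  have i2 : Integrable (fun y : ℝ × E => τ y.1 * Φ' y.1 y.2) ((P.map X).prod (P.map Z)) := by
    rw [← hlaw, integrable_map_measure m2.aestronglyMeasurable hXZm.aemeasurable]
    exact hi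
  have e1 : ∫ ω, X ω * Φ (X ω) (Z ω) ∂P = ∫ z, ∫ x, x * Φ x z ∂(P.map X) ∂(P.map Z) := by
    rw [← integral_prod_symm (fun y : ℝ × E => y.1 * Φ y.1 y.2) i1, ← hlaw,
      integral_map hXZm.aemeasurable m1.aestronglyMeasurable]
  have e2 : ∫ ω, τ (X ω) * Φ' (X ω) (Z ω) ∂P =
      ∫ z, ∫ x, τ x * Φ' x z ∂(P.map X) ∂(P.map Z) := by
    rw [← integral_prod_symm (fun y : ℝ × E => τ y.1 * Φ' y.1 y.2) i2, ← hlaw,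
      integral_map hXZm.aemeasurable m2.aestronglyMeasurable]
  rw [e1, e2]
  refine integral_congr_ae ?_
  filter_upwards [i2.prod_left_ae] with z hz
  exact hτ.integral_mul (fun x => Φ x z) (fun x => Φ' x z) C (fun x hx => hd x hx z)
    (fun x _ => hC x z) hz

/-- A regularized reciprocal. -/
def regInv (ε z : ℝ) : ℝ := z / (z ^ 2 + ε)

/-- The derivative of the regularized reciprocal. -/
def regInvDeriv (ε z : ℝ) : ℝ := (ε - z ^ 2) / (z ^ 2 + ε) ^ 2

theorem hasDerivAt_regInv {ε : ℝ} (hε : 0 < ε) (z : ℝ) :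
    HasDerivAt (regInv ε) (regInvDeriv ε z) z := by
  have h : z ^ 2 + ε ≠ 0 := by positivity
  refine ((hasDerivAt_id z).div ((hasDerivAt_pow 2 z).add_const ε) h).congr_deriv ?_
  simp only [regInvDeriv, id]
  congr 1
  push_cast
  ring

/-- The true reciprocal is unbounded and singular at zero. For fixed `ε` this bound makes the
regularized one admissible in the Stein identity; bounds uniform in `ε` need `z ≠ 0` and enter when
the regularization is removed. -/
theorem abs_regInv_le {ε : ℝ} (hε : 0 < ε) (z : ℝ) : |regInv ε z| ≤ 1 + 1 / ε := by
  have h : 0 < z ^ 2 + ε := by positivity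
  rw [regInv, abs_div, abs_of_pos h, div_le_iff₀ h]
  have h1 : |z| ≤ z ^ 2 + 1 := by nlinarith [sq_abs z, sq_nonneg (|z| - 1), abs_nonneg z]
  have h2 : (1 + 1 / ε) * (z ^ 2 + ε) = z ^ 2 + 1 + (ε + z ^ 2 / ε) := by field_simp; ring
  have h3 : 0 ≤ ε + z ^ 2 / ε := by positivity
  linarith

theorem abs_regInvDeriv_le {ε : ℝ} (hε : 0 < ε) (z : ℝ) :
    |regInvDeriv ε z| ≤ 1 / (z ^ 2 + ε) := by
  have h : 0 < z ^ 2 + ε := by positivity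
  rw [regInvDeriv, abs_div, abs_of_pos (by positivity : 0 < (z ^ 2 + ε) ^ 2),
    div_le_div_iff₀ (by positivity) h]
  have : |ε - z ^ 2| ≤ z ^ 2 + ε := by rw [abs_le]; constructor <;> nlinarith [sq_nonneg z]
  nlinarith

theorem measurable_regInv (ε : ℝ) : Measurable (regInv ε) := by unfold regInv; fun_prop

theorem measurable_regInvDeriv (ε : ℝ) : Measurable (regInvDeriv ε) := by
  unfold regInvDeriv; fun_prop

/-- Dominates a partial derivative of the regularized test function by a square-integrable variable,
in `integral_sum_regInv`. -/
theorem abs_mul_add_mul_le {κ a b r p r' b' T t C R : ℝ} (ha : |a| ≤ C) (hb : |b| ≤ C)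
    (hr : |r| ≤ R) (hp : |p| ≤ C) (hr' : |r'| ≤ R) (hb' : |b'| ≤ C) :
    |κ * a * b * r + p * (r' * (b' * T + b * t))| ≤
      |κ| * C * C * R + C * (R * (C * |T| + C * |t|)) := by
  have hC : 0 ≤ C := (abs_nonneg _).trans ha
  have hR : 0 ≤ R := (abs_nonneg _).trans hr
  have h1 : |κ * a * b * r| ≤ |κ| * C * C * R := by simp only [abs_mul]; gcongr
  have h2 : |b' * T + b * t| ≤ C * |T| + C * |t| :=
    (abs_add_le _ _).trans (by simp only [abs_mul]; gcongr)
  have h3 : |p * (r' * (b' * T + b * t))| ≤ C * (R * (C * |T| + C * |t|)) := by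
    rw [abs_mul p, abs_mul r']; gcongr
  exact (abs_add_le _ _).trans (add_le_add h1 h3)

variable {X : ℕ → Ω → ℝ} {J : ℕ → Set ℝ} {τ τ' : ℕ → ℝ → ℝ}

/-- Integration by parts for a function of the sums `∑ X_k` and `∑ τ_k(X_k)`, before removing
the regularization of the reciprocal. -/
theorem integral_sum_regInv (hX : ∀ k, Measurable (X k)) (hi : iIndepFun X P)
    (hτ : ∀ k, IsSteinKernel (P.map (X k)) (J k) (τ k) (τ' k))
    (hX2 : ∀ k, MemLp (X k) 2 P) (hτ2 : ∀ k, MemLp (fun ω => τ k (X k ω)) 2 P)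
    (hτ'2 : ∀ k, MemLp (fun ω => τ' k (X k ω)) 2 P)
    {f d d' φ ψ : ℝ → ℝ} {κ C ε : ℝ} (hε : 0 < ε)
    (hf : ∀ s, HasDerivAt f (κ * d s) s) (hd : ∀ s, HasDerivAt d (d' s) s)
    (hd' : Measurable d') (hdC : ∀ s, |d s| ≤ C) (hd'C : ∀ s, |d' s| ≤ C)
    (hφ : ∀ x, HasDerivAt φ (ψ x) x) (hψ : Continuous ψ)
    (hφC : ∀ x, |φ x| ≤ C) (hψC : ∀ x, |ψ x| ≤ C) (n : ℕ) {S T U D : Ω → ℝ}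
    (hS : S = fun ω => ∑ k ∈ Finset.range n, X k ω)
    (hT : T = fun ω => ∑ k ∈ Finset.range n, τ k (X k ω))
    (hU : U = fun ω => ∑ k ∈ Finset.range n, τ k (X k ω) * τ' k (X k ω))
    (hD : D = fun ω => d (S ω) * T ω) :
    ∫ ω, S ω * (φ (f (S ω)) * regInv ε (D ω)) ∂P =
      ∫ ω, (κ * (ψ (f (S ω)) * (D ω * regInv ε (D ω))) +
        φ (f (S ω)) * (regInvDeriv ε (D ω) * (d' (S ω) * T ω ^ 2 + d (S ω) * U ω))) ∂P := by
  have hC0 : 0 ≤ C := (abs_nonneg _).trans (hφC 0)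
  have hdm : Measurable d :=
    (continuous_iff_continuousAt.2 fun x => (hd x).continuousAt).measurable
  have hfm : Measurable f :=
    (continuous_iff_continuousAt.2 fun x => (hf x).continuousAt).measurable
  have hφm : Measurable φ :=
    (continuous_iff_continuousAt.2 fun x => (hφ x).continuousAt).measurable
  have hψm := hψ.measurable
  have hτm := fun k => (hτ k).measurable
  have hτm' := fun k => (hτ k).measurable_deriv
  have hr := measurable_regInv ε
  have hr' := measurable_regInvDeriv ε
  have hSm : Measurable S := by rw [hS]; fun_prop
  have hTm : Measurable T := by rw [hT]; fun_prop
  have hDm : Measurable D := by rw [hD]; fun_prop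
  have hT2 : MemLp T 2 P := by rw [hT]; exact memLp_finsetSum _ fun k _ => hτ2 k
  set R : ℝ := 1 + 1 / ε with hR
  have hR' : ∀ z, |regInvDeriv ε z| ≤ R := fun z => (abs_regInvDeriv_le hε z).trans (by
    have : 1 / (z ^ 2 + ε) ≤ 1 / ε := one_div_le_one_div_of_le hε (by nlinarith [sq_nonneg z])
    linarith)
  have hR0 : 0 ≤ R := by positivity
  -- `G k` is the partial derivative of `φ (f S) * regInv ε D` in the `k`-th variable. Because `f' =
  -- κ d` and `D = d(S) T`, weighting by `τ k` and summing produces `κ D` in front of `regInv ε D`.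
  set G : ℕ → Ω → ℝ := fun k ω => κ * ψ (f (S ω)) * d (S ω) * regInv ε (D ω) +
    φ (f (S ω)) * (regInvDeriv ε (D ω) * (d' (S ω) * T ω + d (S ω) * τ' k (X k ω))) with hG
  have hGi : ∀ k, Integrable (fun ω => τ k (X k ω) * G k ω) P := by
    intro k
    have hGm : Measurable (G k) := by simp only [hG]; fun_prop
    refine (hτ2 k).integrable_mul (q := 2) ?_
    refine MemLp.of_le (g := fun ω => |κ| * C * C * R + C * (R * (C * |T ω| +
      C * |τ' k (X k ω)|))) ?_ hGm.aestronglyMeasurable (ae_of_all _ fun ω => ?_)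
    · have h1 : MemLp (fun ω => C * |T ω|) 2 P := hT2.abs.const_mul C
      have h2 : MemLp (fun ω => C * |τ' k (X k ω)|) 2 P := (hτ'2 k).abs.const_mul C
      have h3 : MemLp (fun ω => C * |T ω| + C * |τ' k (X k ω)|) 2 P := h1.add h2
      have h4 : MemLp (fun ω => C * (R * (C * |T ω| + C * |τ' k (X k ω)|))) 2 P :=
        (h3.const_mul R).const_mul C
      have h5 : MemLp (fun _ : Ω => |κ| * C * C * R) 2 P := memLp_const _
      exact h5.add h4
    · exact (abs_mul_add_mul_le (hψC _) (hdC _) (abs_regInv_le hε _) (hφC _) (hR' _)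
        (hd'C _)).trans (le_abs_self _)
  have hk : ∀ k ∈ Finset.range n, ∫ ω, X k ω * (φ (f (S ω)) * regInv ε (D ω)) ∂P =
      ∫ ω, τ k (X k ω) * G k ω ∂P := by
    intro k hk
    -- The other variables enter only through the pair `Z` of partial sums, which is independent of
    -- `X k`, so the one-variable formula applies with `Z` frozen.
    set V : ℕ → Ω → ℝ × ℝ := fun j ω => (X j ω, τ j (X j ω)) with hV
    have hVm : ∀ j, Measurable (V j) := fun j => (hX j).prodMk ((hτm j).comp (hX j))
    have hVi : iIndepFun V P := hi.comp (fun j x => (x, τ j x))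
      fun j => measurable_id.prodMk (hτm j)
    set Z : Ω → ℝ × ℝ := ∑ j ∈ (Finset.range n).erase k, V j with hZ
    have hZm : Measurable Z := by
      have := Finset.measurable_sum ((Finset.range n).erase k) fun j _ => hVm j
      convert this using 1
      funext ω
      simp only [hZ, Finset.sum_apply]
    have hind : IndepFun (X k) Z P :=
      ((hVi.indepFun_finsetSum_of_notMem hVm (Finset.notMem_erase k (Finset.range n))).comp
        measurable_id measurable_fst).symm
    have hZ1 : ∀ ω, (Z ω).1 + X k ω = S ω := by
      intro ω
      have : (Z ω).1 = ∑ j ∈ (Finset.range n).erase k, X j ω := by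
        rw [hZ, Finset.sum_apply, Prod.fst_sum]
      rw [this, hS, Finset.sum_erase_add _ _ hk]
    have hZ2 : ∀ ω, (Z ω).2 + τ k (X k ω) = T ω := by
      intro ω
      have : (Z ω).2 = ∑ j ∈ (Finset.range n).erase k, τ j (X j ω) := by
        rw [hZ, Finset.sum_apply, Prod.snd_sum]
      rw [this, hT, Finset.sum_erase_add _ _ hk]
    have main := (hτ k).integral_mul_of_indepFun (hX k) hZm hind ((hX2 k).integrable one_le_two)
      (Φ := fun x z => φ (f (z.1 + x)) * regInv ε (d (z.1 + x) * (z.2 + τ k x)))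
      (Φ' := fun x z => κ * ψ (f (z.1 + x)) * d (z.1 + x) *
        regInv ε (d (z.1 + x) * (z.2 + τ k x)) + φ (f (z.1 + x)) *
        (regInvDeriv ε (d (z.1 + x) * (z.2 + τ k x)) *
          (d' (z.1 + x) * (z.2 + τ k x) + d (z.1 + x) * τ' k x))) (C := C * R)
      (by unfold Function.uncurry; fun_prop) (by unfold Function.uncurry; fun_prop)
      (fun x z => by rw [abs_mul]; gcongr; exacts [hφC _, abs_regInv_le hε _])
      (fun x hx z => by
        have hadd : HasDerivAt (fun x => z.1 + x) 1 x := (hasDerivAt_id x).const_add _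
        have h1 : HasDerivAt (fun x => φ (f (z.1 + x)))
            (ψ (f (z.1 + x)) * (κ * d (z.1 + x) * 1)) x :=
          (hφ _).comp x ((hf _).comp x hadd)
        have h2 : HasDerivAt (fun x => d (z.1 + x)) (d' (z.1 + x) * 1) x := (hd _).comp x hadd
        have h3 : HasDerivAt (fun x => z.2 + τ k x) (τ' k x) x :=
          ((hτ k).hasDerivAt x hx).const_add _
        have h4 : HasDerivAt (fun x => regInv ε (d (z.1 + x) * (z.2 + τ k x))) _ x :=
          (hasDerivAt_regInv hε _).comp x (h2.mul h3)
        refine (h1.mul h4).congr_deriv ?_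
        ring)
      (by simpa only [hZ1, hZ2, hD, hG] using hGi k)
    simpa only [hZ1, hZ2, hD, hG] using main
  have hXi : ∀ k ∈ Finset.range n,
      Integrable (fun ω => X k ω * (φ (f (S ω)) * regInv ε (D ω))) P := fun k _ =>
    ((hX2 k).integrable one_le_two).mul_bdd (c := C * R)
      (by fun_prop : Measurable fun ω => φ (f (S ω)) * regInv ε (D ω)).aestronglyMeasurable
      (ae_of_all _ fun ω => by
        rw [Real.norm_eq_abs, abs_mul]; gcongr; exacts [hφC _, abs_regInv_le hε _])
  calc ∫ ω, S ω * (φ (f (S ω)) * regInv ε (D ω)) ∂P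
      = ∫ ω, ∑ k ∈ Finset.range n, X k ω * (φ (f (S ω)) * regInv ε (D ω)) ∂P := by
        refine integral_congr_ae (ae_of_all _ fun ω => ?_)
        dsimp only
        rw [← Finset.sum_mul, hS]
    _ = ∫ ω, ∑ k ∈ Finset.range n, τ k (X k ω) * G k ω ∂P := by
        rw [integral_finsetSum _ hXi, integral_finsetSum _ fun k _ => hGi k]
        exact Finset.sum_congr rfl hk
    _ = _ := by
        refine integral_congr_ae (ae_of_all _ fun ω => ?_)
        have hT' : T ω = ∑ k ∈ Finset.range n, τ k (X k ω) := by rw [hT]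
        have hU' : U ω = ∑ k ∈ Finset.range n, τ k (X k ω) * τ' k (X k ω) := by rw [hU]
        have hD' : D ω = d (S ω) * T ω := by rw [hD]
        have hterm : ∀ k, τ k (X k ω) * G k ω = τ k (X k ω) * (κ * ψ (f (S ω)) * d (S ω) *
            regInv ε (D ω) + φ (f (S ω)) * (regInvDeriv ε (D ω) * (d' (S ω) * T ω))) +
            τ k (X k ω) * τ' k (X k ω) * (φ (f (S ω)) * (regInvDeriv ε (D ω) * d (S ω))) := by
          intro k; simp only [hG]; ring
        simp only [hterm]
        rw [Finset.sum_add_distrib, ← Finset.sum_mul, ← Finset.sum_mul, ← hT', ← hU',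
          show κ * (ψ (f (S ω)) * (D ω * regInv ε (D ω))) =
            κ * (ψ (f (S ω)) * (d (S ω) * T ω * regInv ε (D ω))) by rw [← hD']]
        ring

/-- Integration by parts for a function of the sums `∑ X_k` and `∑ τ_k(X_k)`. -/
theorem integral_sum_inv (hX : ∀ k, Measurable (X k)) (hi : iIndepFun X P)
    (hτ : ∀ k, IsSteinKernel (P.map (X k)) (J k) (τ k) (τ' k))
    (hX2 : ∀ k, MemLp (X k) 2 P) (hτ2 : ∀ k, MemLp (fun ω => τ k (X k ω)) 2 P)
    (hτ'2 : ∀ k, MemLp (fun ω => τ' k (X k ω)) 2 P)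
    {f d d' φ ψ : ℝ → ℝ} {κ C : ℝ}
    (hf : ∀ s, HasDerivAt f (κ * d s) s) (hd : ∀ s, HasDerivAt d (d' s) s)
    (hd' : Measurable d') (hdC : ∀ s, |d s| ≤ C) (hd'C : ∀ s, |d' s| ≤ C)
    (hφ : ∀ x, HasDerivAt φ (ψ x) x) (hψ : Continuous ψ)
    (hφC : ∀ x, |φ x| ≤ C) (hψC : ∀ x, |ψ x| ≤ C) (n : ℕ) {S T U D : Ω → ℝ}
    (hS : S = fun ω => ∑ k ∈ Finset.range n, X k ω)
    (hT : T = fun ω => ∑ k ∈ Finset.range n, τ k (X k ω))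
    (hU : U = fun ω => ∑ k ∈ Finset.range n, τ k (X k ω) * τ' k (X k ω))
    (hD : D = fun ω => d (S ω) * T ω) (hD0 : ∀ᵐ ω ∂P, D ω ≠ 0)
    (hi1 : Integrable (fun ω => S ω * (D ω)⁻¹) P)
    (hi2 : Integrable (fun ω => (d' (S ω) * T ω ^ 2 + d (S ω) * U ω) * ((D ω)⁻¹ * (D ω)⁻¹)) P) :
    κ * ∫ ω, ψ (f (S ω)) ∂P = ∫ ω, φ (f (S ω)) * (S ω * (D ω)⁻¹ +
      (d' (S ω) * T ω ^ 2 + d (S ω) * U ω) * ((D ω)⁻¹ * (D ω)⁻¹)) ∂P := by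
  have hC0 : 0 ≤ C := (abs_nonneg _).trans (hφC 0)
  have hdm : Measurable d :=
    (continuous_iff_continuousAt.2 fun x => (hd x).continuousAt).measurable
  have hfm : Measurable f :=
    (continuous_iff_continuousAt.2 fun x => (hf x).continuousAt).measurable
  have hφm : Measurable φ :=
    (continuous_iff_continuousAt.2 fun x => (hφ x).continuousAt).measurable
  have hψm := hψ.measurable
  have hτm := fun k => (hτ k).measurable
  have hτm' := fun k => (hτ k).measurable_deriv
  have hSm : Measurable S := by rw [hS]; fun_prop
  have hTm : Measurable T := by rw [hT]; fun_prop
  have hUm : Measurable U := by rw [hU]; fun_prop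
  have hDm : Measurable D := by rw [hD]; fun_prop
  set Q : Ω → ℝ := fun ω => d' (S ω) * T ω ^ 2 + d (S ω) * U ω with hQ
  have hQm : Measurable Q := by simp only [hQ]; fun_prop
  set e : ℕ → ℝ := fun m => 1 / ((m : ℝ) + 1) with he
  have he0 : ∀ m, 0 < e m := fun m => by simp only [he]; positivity
  have hel : Tendsto e atTop (𝓝 0) := tendsto_one_div_add_atTop_nhds_zero_nat
  have hrl : ∀ z : ℝ, z ≠ 0 → Tendsto (fun m => regInv (e m) z) atTop (𝓝 z⁻¹) := by
    intro z hz
    have h1 : Tendsto (fun m => z / (z ^ 2 + e m)) atTop (𝓝 (z / (z ^ 2 + 0))) :=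
      tendsto_const_nhds.div (tendsto_const_nhds.add hel) (by positivity)
    have : z / (z ^ 2 + 0) = z⁻¹ := by field_simp; ring
    rwa [this] at h1
  have hrl' : ∀ z : ℝ, z ≠ 0 → Tendsto (fun m => regInvDeriv (e m) z) atTop (𝓝 (-(z⁻¹ * z⁻¹))) := by
    intro z hz
    have h1 : Tendsto (fun m => (e m - z ^ 2) / (z ^ 2 + e m) ^ 2) atTop
        (𝓝 ((0 - z ^ 2) / (z ^ 2 + 0) ^ 2)) :=
      (hel.sub tendsto_const_nhds).div ((tendsto_const_nhds.add hel).pow 2) (by positivity)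
    have : (0 - z ^ 2) / (z ^ 2 + 0) ^ 2 = -(z⁻¹ * z⁻¹) := by field_simp; ring
    rwa [this] at h1
  -- These bounds are uniform in the regularization, so the assumed integrability of `S / D` and `Q
  -- / D²` supplies the dominating functions.
  have hrb : ∀ m, ∀ z : ℝ, z ≠ 0 → |regInv (e m) z| ≤ |z⁻¹| := by
    intro m z hz
    have h1 : 0 < z ^ 2 + e m := add_pos_of_nonneg_of_pos (sq_nonneg _) (he0 m)
    rw [regInv, abs_div, abs_inv, abs_of_pos h1, div_le_iff₀ h1, inv_mul_eq_div,
      le_div_iff₀ (abs_pos.2 hz), ← sq, sq_abs]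
    linarith [he0 m]
  have hrb' : ∀ m, ∀ z : ℝ, z ≠ 0 → |regInvDeriv (e m) z| ≤ |z⁻¹ * z⁻¹| := by
    intro m z hz
    refine (abs_regInvDeriv_le (he0 m) z).trans ?_
    rw [abs_mul, abs_mul_abs_self, ← mul_inv, ← sq, one_div]
    exact inv_anti₀ (by positivity) (by linarith [he0 m])
  have hr := fun m => measurable_regInv (e m)
  have hr' := fun m => measurable_regInvDeriv (e m)
  have L1 : Tendsto (fun m => ∫ ω, S ω * (φ (f (S ω)) * regInv (e m) (D ω)) ∂P) atTop
      (𝓝 (∫ ω, S ω * (φ (f (S ω)) * (D ω)⁻¹) ∂P)) := by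
    refine tendsto_integral_of_dominated_convergence (fun ω => C * |S ω * (D ω)⁻¹|)
      (fun m => Measurable.aestronglyMeasurable (by fun_prop)) (hi1.abs.const_mul C) ?_ ?_
    · intro m
      filter_upwards [hD0] with ω hω
      rw [Real.norm_eq_abs, abs_mul, abs_mul, abs_mul, mul_left_comm]
      exact mul_le_mul (hφC _) (mul_le_mul_of_nonneg_left (hrb m _ hω) (abs_nonneg _))
        (by positivity) hC0
    · filter_upwards [hD0] with ω hω
      exact ((hrl _ hω).const_mul _).const_mul _
  have L2 : Tendsto (fun m => ∫ ω, (κ * (ψ (f (S ω)) * (D ω * regInv (e m) (D ω))) +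
        φ (f (S ω)) * (regInvDeriv (e m) (D ω) * Q ω)) ∂P) atTop
      (𝓝 (∫ ω, (κ * (ψ (f (S ω)) * (D ω * (D ω)⁻¹)) +
        φ (f (S ω)) * (-((D ω)⁻¹ * (D ω)⁻¹) * Q ω)) ∂P)) := by
    refine tendsto_integral_of_dominated_convergence
      (fun ω => |κ| * C + C * |Q ω * ((D ω)⁻¹ * (D ω)⁻¹)|)
      (fun m => Measurable.aestronglyMeasurable (by fun_prop))
      ((integrable_const _).add (hi2.abs.const_mul C)) ?_ ?_
    · intro m
      filter_upwards [hD0] with ω hω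
      rw [Real.norm_eq_abs]
      refine (abs_add_le _ _).trans ?_
      rw [abs_mul κ, abs_mul (ψ _), abs_mul (φ _), mul_comm (Q ω), abs_mul _ (Q ω),
        abs_mul _ (Q ω)]
      have h1 : |D ω * regInv (e m) (D ω)| ≤ 1 := by
        calc |D ω * regInv (e m) (D ω)| = |D ω| * |regInv (e m) (D ω)| := abs_mul _ _
          _ ≤ |D ω| * |(D ω)⁻¹| := mul_le_mul_of_nonneg_left (hrb m _ hω) (abs_nonneg _)
          _ = 1 := by rw [← abs_mul, mul_inv_cancel₀ hω, abs_one]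
      have h2 : |ψ (f (S ω))| * |D ω * regInv (e m) (D ω)| ≤ C := by
        calc _ ≤ C * 1 := by gcongr; exact hψC _
          _ = C := mul_one C
      exact add_le_add (mul_le_mul_of_nonneg_left h2 (abs_nonneg _)) (mul_le_mul (hφC _)
        (mul_le_mul_of_nonneg_right (hrb' m _ hω) (abs_nonneg _)) (by positivity) hC0)
    · filter_upwards [hD0] with ω hω
      exact ((((hrl _ hω).const_mul _).const_mul _).const_mul κ).add
        (((hrl' _ hω).mul_const _).const_mul _)
  have heq := fun m => integral_sum_regInv hX hi hτ hX2 hτ2 hτ'2 (he0 m) hf hd hd' hdC hd'C hφ hψ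
    hφC hψC n hS hT hU hD
  have hlim := tendsto_nhds_unique L1 (by simpa only [heq] using L2)
  have hψi : Integrable (fun ω => ψ (f (S ω))) P :=
    Integrable.of_bound (Measurable.aestronglyMeasurable (by fun_prop)) C
      (ae_of_all _ fun ω => hψC _)
  have hφi1 : Integrable (fun ω => φ (f (S ω)) * (S ω * (D ω)⁻¹)) P :=
    hi1.bdd_mul (c := C) (Measurable.aestronglyMeasurable (by fun_prop))
      (ae_of_all _ fun ω => hφC _)
  have hφi2 : Integrable (fun ω => φ (f (S ω)) * (Q ω * ((D ω)⁻¹ * (D ω)⁻¹))) P :=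
    hi2.bdd_mul (c := C) (Measurable.aestronglyMeasurable (by fun_prop))
      (ae_of_all _ fun ω => hφC _)
  have e1 : ∫ ω, S ω * (φ (f (S ω)) * (D ω)⁻¹) ∂P = ∫ ω, φ (f (S ω)) * (S ω * (D ω)⁻¹) ∂P :=
    integral_congr_ae (ae_of_all _ fun ω => by ring)
  have e2 : ∫ ω, (κ * (ψ (f (S ω)) * (D ω * (D ω)⁻¹)) +
        φ (f (S ω)) * (-((D ω)⁻¹ * (D ω)⁻¹) * Q ω)) ∂P =
      κ * ∫ ω, ψ (f (S ω)) ∂P - ∫ ω, φ (f (S ω)) * (Q ω * ((D ω)⁻¹ * (D ω)⁻¹)) ∂P := by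
    rw [← integral_const_mul, ← integral_sub (hψi.const_mul κ) hφi2]
    refine integral_congr_ae ?_
    filter_upwards [hD0] with ω hω
    rw [mul_inv_cancel₀ hω]; ring
  rw [e1, e2] at hlim
  have e3 : ∫ ω, φ (f (S ω)) * (S ω * (D ω)⁻¹ + Q ω * ((D ω)⁻¹ * (D ω)⁻¹)) ∂P =
      ∫ ω, φ (f (S ω)) * (S ω * (D ω)⁻¹) ∂P +
        ∫ ω, φ (f (S ω)) * (Q ω * ((D ω)⁻¹ * (D ω)⁻¹)) ∂P := by
    rw [← integral_add hφi1 hφi2]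
    exact integral_congr_ae (ae_of_all _ fun ω => mul_add _ _ _)
  rw [e3, hlim]; ring

end Kernel

/-! ### Calculus of `L^p` bounds with real constants. -/

section LpBound

variable {Ω : Type*} [MeasurableSpace Ω] {P : Measure Ω} {p : ℝ≥0∞} {f g : Ω → ℝ} {a b : ℝ}

/-- The `L^p` norm of `f` is at most the real number `a`. -/
structure LpLE (P : Measure Ω) (p : ℝ≥0∞) (f : Ω → ℝ) (a : ℝ) : Prop where
  aesm : AEStronglyMeasurable f P
  nonneg : 0 ≤ a
  le : eLpNorm f p P ≤ ENNReal.ofReal a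

theorem LpLE.memLp (h : LpLE P p f a) : MemLp f p P := ⟨h.aesm, h.le.trans_lt ENNReal.ofReal_lt_top⟩

theorem LpLE.mono (h : LpLE P p f a) (hab : a ≤ b) : LpLE P p f b :=
  ⟨h.aesm, h.nonneg.trans hab, h.le.trans (ENNReal.ofReal_le_ofReal hab)⟩

theorem LpLE.add (hf : LpLE P p f a) (hg : LpLE P p g b) (hp : 1 ≤ p) :
    LpLE P p (fun ω => f ω + g ω) (a + b) :=
  ⟨hf.aesm.add hg.aesm, add_nonneg hf.nonneg hg.nonneg,
    (eLpNorm_add_le hf.aesm hg.aesm hp).trans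
      ((add_le_add hf.le hg.le).trans (ENNReal.ofReal_add hf.nonneg hg.nonneg).ge)⟩

theorem LpLE.of_ae_abs_le (hg : LpLE P p g a) (hf : AEStronglyMeasurable f P) {t : ℝ}
    (ht : 0 ≤ t) (h : ∀ᵐ ω ∂P, |f ω| ≤ t * |g ω|) : LpLE P p f (t * a) := by
  refine ⟨hf, mul_nonneg ht hg.nonneg, ?_⟩
  refine (eLpNorm_le_mul_eLpNorm_of_ae_le_mul (g := g) (c := t) h p).trans ?_
  rw [ENNReal.ofReal_mul ht]
  gcongr
  exact hg.le

theorem LpLE.const_mul (hf : LpLE P p f a) (c : ℝ) : LpLE P p (fun ω => c * f ω) (|c| * a) :=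
  hf.of_ae_abs_le (hf.aesm.const_mul c) (abs_nonneg c) (ae_of_all _ fun _ => (abs_mul _ _).le)

theorem LpLE.mul {q r : ℝ≥0∞} [hpqr : ENNReal.HolderTriple p q r] (hf : LpLE P p f a)
    (hg : LpLE P q g b) : LpLE P r (fun ω => f ω * g ω) (a * b) := by
  refine ⟨hf.aesm.mul hg.aesm, mul_nonneg hf.nonneg hg.nonneg, ?_⟩
  have h := eLpNorm_smul_le_mul_eLpNorm (p := p) (q := q) (r := r) hg.aesm hf.aesm
  refine h.trans ?_
  rw [ENNReal.ofReal_mul hf.nonneg]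
  exact mul_le_mul' hf.le hg.le

theorem LpLE.mono_exponent [IsProbabilityMeasure P] {q : ℝ≥0∞} (hf : LpLE P p f a) (hqp : q ≤ p) :
    LpLE P q f a :=
  ⟨hf.aesm, hf.nonneg, (eLpNorm_le_eLpNorm_of_exponent_le hqp hf.aesm).trans hf.le⟩

theorem LpLE.const [IsProbabilityMeasure P] (c : ℝ) (hp : p ≠ 0) :
    LpLE P p (fun _ => c) |c| := by
  refine ⟨aestronglyMeasurable_const, abs_nonneg c, ?_⟩
  rw [eLpNorm_const c hp (IsProbabilityMeasure.ne_zero P)]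
  simp [Real.enorm_eq_ofReal_abs]

theorem LpLE.sum {f : ℕ → Ω → ℝ} (hf : ∀ k, LpLE P p (f k) a) (hp : 1 ≤ p) (n : ℕ) :
    LpLE P p (fun ω => ∑ k ∈ Finset.range n, f k ω) (n * a) := by
  induction n with
  | zero =>
    refine ⟨by simpa using aestronglyMeasurable_const, by simp, ?_⟩
    simp
  | succ n ih =>
    simp only [Finset.sum_range_succ]
    refine (ih.add (hf n) hp).mono (le_of_eq ?_)
    push_cast
    ring

theorem LpLE.of_integral_pow_le {m : ℕ} (hm : m ≠ 0) (heven : Even m) (hf : MemLp f m P)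
    (ha : 0 ≤ a) (h : ∫ ω, f ω ^ m ∂P ≤ a ^ m) : LpLE P m f a := by
  refine ⟨hf.1, ha, ?_⟩
  rw [hf.eLpNorm_eq_integral_rpow_norm (by exact_mod_cast hm) (by simp)]
  refine ENNReal.ofReal_le_ofReal ?_
  have e : ∫ ω, ‖f ω‖ ^ ((m : ℝ≥0∞).toReal) ∂P = ∫ ω, f ω ^ m ∂P := by
    refine integral_congr_ae (ae_of_all _ fun ω => ?_)
    simp [heven.pow_abs]
  rw [e, ENNReal.toReal_natCast]
  calc (∫ ω, f ω ^ m ∂P) ^ ((m : ℝ)⁻¹) ≤ (a ^ m) ^ ((m : ℝ)⁻¹) :=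
        Real.rpow_le_rpow (integral_nonneg fun ω => heven.pow_nonneg _) h (by positivity)
    _ = a := Real.pow_rpow_inv_natCast ha hm

theorem LpLE.integral_pow_le {m : ℕ} (hm : m ≠ 0) (heven : Even m) (hf : LpLE P m f a) :
    ∫ ω, f ω ^ m ∂P ≤ a ^ m := by
  have h := hf.le
  rw [hf.memLp.eLpNorm_eq_integral_rpow_norm (by exact_mod_cast hm) (by simp),
    ENNReal.ofReal_le_ofReal_iff hf.nonneg] at h
  simp only [ENNReal.toReal_natCast, Real.rpow_natCast, Real.norm_eq_abs, heven.pow_abs] at h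
  have h0 : 0 ≤ ∫ ω, f ω ^ m ∂P := integral_nonneg fun ω => heven.pow_nonneg _
  calc ∫ ω, f ω ^ m ∂P = ((∫ ω, f ω ^ m ∂P) ^ ((m : ℝ)⁻¹)) ^ m :=
        (Real.rpow_inv_natCast_pow h0 hm).symm
    _ ≤ a ^ m := by gcongr

theorem LpLE.of_lintegral_pow_le {m : ℕ} (hm : m ≠ 0) (hf : AEStronglyMeasurable f P) {β : ℝ≥0}
    (h : ∫⁻ ω, ‖f ω‖ₑ ^ m ∂P ≤ β) : LpLE P m f ((β : ℝ) ^ ((m : ℝ)⁻¹)) := by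
  refine ⟨hf, by positivity, ?_⟩
  rw [eLpNorm_eq_lintegral_rpow_enorm_toReal (by exact_mod_cast hm) (by simp)]
  simp only [ENNReal.toReal_natCast, ENNReal.rpow_natCast, one_div]
  rw [← ENNReal.ofReal_rpow_of_nonneg (by positivity) (by positivity), ENNReal.ofReal_coe_nnreal]
  gcongr

theorem holderTriple_two_mul_self (p : ℝ≥0∞) : ENNReal.HolderTriple (2 * p) (2 * p) p := by
  refine ⟨?_⟩
  rw [ENNReal.mul_inv (by simp) (by simp), ← add_mul, ENNReal.inv_two_add_inv_two, one_mul]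

instance : ENNReal.HolderTriple 8 8 4 := by
  have := holderTriple_two_mul_self 4
  rwa [show (2 * 4 : ℝ≥0∞) = 8 by norm_num] at this

instance : ENNReal.HolderTriple 4 4 2 := by
  have := holderTriple_two_mul_self 2
  rwa [show (2 * 2 : ℝ≥0∞) = 4 by norm_num] at this

end LpBound

/-! ### Taylor bounds, and the mean of the Stein kernel. -/

/-- The mean value inequality twice, the second time for `H y - H'(0) y` on the segment from `0` to
`x`, where its derivative is at most `M * |x|`. The factor `1/2` of Taylor's formula is lost, but no
continuity of `H''` is needed. -/
theorem abs_sub_sub_mul_le {H : ℝ → ℝ} {M : ℝ} (hH : Differentiable ℝ H)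
    (hH' : Differentiable ℝ (deriv H)) (hM : ∀ x, |deriv (deriv H) x| ≤ M) (x : ℝ) :
    |deriv H x - deriv H 0| ≤ M * |x| ∧ |H x - H 0 - deriv H 0 * x| ≤ M * x ^ 2 := by
  have h1 : ∀ y, |deriv H y - deriv H 0| ≤ M * |y| := fun y => by
    simpa using convex_univ.norm_image_sub_le_of_norm_deriv_le (f := deriv H) (C := M)
      (fun z _ => hH' z) (fun z _ => hM z) (mem_univ 0) (mem_univ y)
  refine ⟨h1 x, ?_⟩
  have hM0 : 0 ≤ M := (abs_nonneg _).trans (hM 0)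
  have h2 := (convex_uIcc (0 : ℝ) x).norm_image_sub_le_of_norm_hasDerivWithin_le
    (f := fun y => H y - deriv H 0 * y) (f' := fun y => deriv H y - deriv H 0 * 1)
    (C := M * |x|) (x := 0) (y := x)
    (fun y _ => ((hH y).hasDerivAt.sub ((hasDerivAt_id y).const_mul _)).hasDerivWithinAt)
    (fun y hy => by
      rw [mul_one, Real.norm_eq_abs]
      refine (h1 y).trans (mul_le_mul_of_nonneg_left ?_ hM0)
      simpa using abs_sub_left_of_mem_uIcc hy)
    left_mem_uIcc right_mem_uIcc
  have e : M * |x| * ‖x - 0‖ = M * x ^ 2 := by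
    rw [sub_zero, Real.norm_eq_abs, mul_assoc, ← sq, sq_abs]
  rw [e] at h2
  refine le_trans (le_of_eq ?_) h2
  rw [Real.norm_eq_abs]
  congr 1
  ring

/-- The mean of the Stein kernel is the variance. -/
theorem IsSteinKernel.integral_eq_integral_sq {μ : Measure ℝ} [IsProbabilityMeasure μ] {J : Set ℝ}
    {τ τ' : ℝ → ℝ} (hτ : IsSteinKernel μ J τ τ') (h2 : MemLp id 2 μ) (hi : Integrable τ μ) :
    ∫ x, τ x ∂μ = ∫ x, x ^ 2 ∂μ := by
  -- The test function `x` itself need not be bounded. It is replaced by `a * regInv a x = x / (1 +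
  -- x² / a)` with `a → ∞`, which tends to `x`, is dominated by `|x|`, and has derivatives bounded
  -- by `1` that tend to `1`.
  set a : ℕ → ℝ := fun m => (m : ℝ) + 1 with ha
  have ha0 : ∀ m, 0 < a m := fun m => by simp only [ha]; positivity
  have hal : Tendsto (fun m => 1 / a m) atTop (𝓝 0) := tendsto_one_div_add_atTop_nhds_zero_nat
  have hGb : ∀ m x, |a m * regInv (a m) x| ≤ |x| := by
    intro m x
    have h1 : 0 < x ^ 2 + a m := add_pos_of_nonneg_of_pos (sq_nonneg _) (ha0 m)
    rw [regInv, abs_mul, abs_div, abs_of_pos h1, abs_of_pos (ha0 m), mul_div_assoc',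
      div_le_iff₀ h1]
    nlinarith [abs_nonneg x, mul_nonneg (abs_nonneg x) (sq_nonneg x)]
  have hG'b : ∀ m x, |a m * regInvDeriv (a m) x| ≤ 1 := by
    intro m x
    have h1 : 0 < x ^ 2 + a m := add_pos_of_nonneg_of_pos (sq_nonneg _) (ha0 m)
    rw [abs_mul, abs_of_pos (ha0 m)]
    calc a m * |regInvDeriv (a m) x| ≤ a m * (1 / (x ^ 2 + a m)) :=
          mul_le_mul_of_nonneg_left (abs_regInvDeriv_le (ha0 m) x) (ha0 m).le
      _ ≤ 1 := by rw [mul_one_div, div_le_one h1]; nlinarith [sq_nonneg x]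
  have hrm := fun m => measurable_regInv (a m)
  have hrm' := fun m => measurable_regInvDeriv (a m)
  have hτm := hτ.measurable
  have hdom : ∀ m, Integrable (fun x => τ x * (a m * regInvDeriv (a m) x)) μ := fun m =>
    hi.mul_bdd (c := 1) (Measurable.aestronglyMeasurable (by fun_prop)) (ae_of_all _ (hG'b m))
  have heq : ∀ m, ∫ x, x * (a m * regInv (a m) x) ∂μ = ∫ x, τ x * (a m * regInvDeriv (a m) x) ∂μ :=
    fun m => hτ.integral_mul _ _ (a m * (1 + 1 / a m))
      (fun x _ => (hasDerivAt_regInv (ha0 m) x).const_mul _)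
      (fun x _ => by
        rw [abs_mul, abs_of_pos (ha0 m)]
        exact mul_le_mul_of_nonneg_left (abs_regInv_le (ha0 m) x) (ha0 m).le) (hdom m)
  have e1 : ∀ m x, a m * regInv (a m) x = x / (1 + x ^ 2 * (1 / a m)) := by
    intro m x
    have h0 := (ha0 m).ne'
    have h1 : x ^ 2 + a m ≠ 0 := by have := ha0 m; positivity
    have h2 : 1 + x ^ 2 * (1 / a m) = (x ^ 2 + a m) / a m := by field_simp; ring
    rw [regInv, h2]
    field_simp
  have e2 : ∀ m x, a m * regInvDeriv (a m) x =
      (1 - x ^ 2 * (1 / a m)) / (1 + x ^ 2 * (1 / a m)) ^ 2 := by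
    intro m x
    have h0 := (ha0 m).ne'
    have h1 : x ^ 2 + a m ≠ 0 := by have := ha0 m; positivity
    have h2 : 1 + x ^ 2 * (1 / a m) = (x ^ 2 + a m) / a m := by field_simp; ring
    rw [regInvDeriv, h2]
    field_simp
  have L1 : Tendsto (fun m => ∫ x, x * (a m * regInv (a m) x) ∂μ) atTop (𝓝 (∫ x, x ^ 2 ∂μ)) := by
    refine tendsto_integral_of_dominated_convergence (fun x => x ^ 2)
      (fun m => Measurable.aestronglyMeasurable (by fun_prop)) h2.integrable_sq
      (fun m => ae_of_all _ fun x => ?_) (ae_of_all _ fun x => ?_)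
    · rw [Real.norm_eq_abs, abs_mul, ← sq_abs, sq]
      exact mul_le_mul_of_nonneg_left (hGb m x) (abs_nonneg _)
    · simp only [e1]
      have : Tendsto (fun m => x * (x / (1 + x ^ 2 * (1 / a m)))) atTop
          (𝓝 (x * (x / (1 + x ^ 2 * 0)))) :=
        (tendsto_const_nhds.div (tendsto_const_nhds.add (hal.const_mul _)) (by simp)).const_mul _
      convert this using 2
      simp [sq]
  have L2 : Tendsto (fun m => ∫ x, τ x * (a m * regInvDeriv (a m) x) ∂μ) atTop
      (𝓝 (∫ x, τ x ∂μ)) := by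
    refine tendsto_integral_of_dominated_convergence (fun x => |τ x|)
      (fun m => (hdom m).1) hi.abs
      (fun m => ae_of_all _ fun x => ?_) (ae_of_all _ fun x => ?_)
    · rw [Real.norm_eq_abs, abs_mul]
      exact mul_le_of_le_one_right (abs_nonneg _) (hG'b m x)
    · simp only [e2]
      have : Tendsto (fun m => τ x * ((1 - x ^ 2 * (1 / a m)) / (1 + x ^ 2 * (1 / a m)) ^ 2)) atTop
          (𝓝 (τ x * ((1 - x ^ 2 * 0) / (1 + x ^ 2 * 0) ^ 2))) :=
        ((tendsto_const_nhds.sub (hal.const_mul _)).div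
          ((tendsto_const_nhds.add (hal.const_mul _)).pow 2) (by simp)).const_mul _
      convert this using 2
      simp
  simp only [heq] at L1
  exact tendsto_nhds_unique L2 L1

/-! ### Standardized sequences: linearization and variance of `F_n`. -/

section

/-- Independent standardized random variables having Stein kernels `τ k`, with eighth moment
bounds. -/
structure SteinSequence {Ω : Type*} [MeasurableSpace Ω] (P : Measure Ω) (X : ℕ → Ω → ℝ)
    (J : ℕ → Set ℝ) (τ τ' : ℕ → ℝ → ℝ) (b : ℝ) : Prop where
  measurable : ∀ k, Measurable (X k)
  indep : iIndepFun X P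
  mean : ∀ k, P[X k] = 0
  var : ∀ k, Var[X k; P] = 1
  kernel : ∀ k, IsSteinKernel (P.map (X k)) (J k) (τ k) (τ' k)
  lpLE : ∀ k, LpLE P 8 (X k) b
  lpLE_kernel : ∀ k, LpLE P 8 (fun ω => τ k (X k ω)) b
  lpLE_deriv : ∀ k, LpLE P 8 (fun ω => τ' k (X k ω)) b

/-- A twice differentiable function with bounds on the first two derivatives. -/
structure IsSmoothTransform (H : ℝ → ℝ) (M₁ M₂ : ℝ) : Prop where
  differentiable : Differentiable ℝ H
  differentiable_deriv : Differentiable ℝ (deriv H)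
  abs_deriv_le : ∀ x, |deriv H x| ≤ M₁
  abs_deriv_deriv_le : ∀ x, |deriv (deriv H) x| ≤ M₂

/-- The constant in the `L⁸` bounds for centered sums. -/
def sumConst (b : ℝ) : ℝ := 22 * (b + 1) ^ 4

/-- The constant in the `L²` bound for the linearization error. -/
def linConst (b M₂ : ℝ) : ℝ := M₂ * sumConst b ^ 2

/-- The constant in the variance bound. -/
def varConst (b M₁ M₂ : ℝ) : ℝ := M₁ ^ 2 + 2 * linConst b M₂ ^ 2

/-- The constant in the `L⁴` bound for `∇ - σ²`. -/
def nablaConst (b M₁ M₂ : ℝ) : ℝ :=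
  M₁ ^ 2 * sumConst b + M₁ * M₂ * sumConst b + varConst b M₁ M₂

/-- The constant in the bound for the Fisher information distance, before squaring. -/
def scoreConst (b M₁ M₂ : ℝ) : ℝ :=
  linConst b M₂ + M₁ * sumConst b * nablaConst b M₁ M₂ +
    (M₁ ^ 2 + varConst b M₁ M₂) * (M₁ * ((M₁ * M₂ + M₁ ^ 2) * b ^ 2))

variable {Ω : Type*} [MeasurableSpace Ω] {P : Measure Ω} {X : ℕ → Ω → ℝ} {J : ℕ → Set ℝ}
  {τ τ' : ℕ → ℝ → ℝ} {H : ℝ → ℝ} {b M₁ M₂ : ℝ}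

theorem SteinSequence.nonneg (h : SteinSequence P X J τ τ' b) : 0 ≤ b := (h.lpLE 0).nonneg

theorem SteinSequence.integral_sq (h : SteinSequence P X J τ τ' b) (k : ℕ) :
    ∫ ω, X k ω ^ 2 ∂P = 1 := by
  rw [← h.var k, variance_of_integral_eq_zero (h.measurable k).aemeasurable (h.mean k)]

theorem SteinSequence.measurable_statF (h : SteinSequence P X J τ τ' b)
    (hH : IsSmoothTransform H M₁ M₂) (n : ℕ) : Measurable (statF P X H n) := by
  have hHm : Measurable H := hH.differentiable.continuous.measurable
  have hX := h.measurable
  unfold statF sampleMean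
  fun_prop

variable [IsProbabilityMeasure P]

/-- Serves both `X_k` and `τ_k(X_k) - 1`. The extra `1` in `b + 1` pays for centring the kernel, and
it makes the moment bound `B = (b + 1) ^ 8` at least `1`. -/
theorem lpLE_sum_range {Y : ℕ → Ω → ℝ} (hm : ∀ k, Measurable (Y k)) (hi : iIndepFun Y P)
    (h0 : ∀ k, P[Y k] = 0) (h8 : ∀ k, LpLE P 8 (Y k) (b + 1)) (hb : 0 ≤ b) (n : ℕ) :
    LpLE P 8 (fun ω => ∑ k ∈ Finset.range n, Y k ω) (sumConst b * √n) := by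
  have h8' : ∀ k, LpLE P ((8 : ℕ) : ℝ≥0∞) (Y k) (b + 1) := fun k => by exact_mod_cast h8 k
  have hsum := integral_sum_range_pow_eight_le hm hi h0 (fun k => (h8 k).memLp)
    (one_le_pow₀ (by linarith) : (1 : ℝ) ≤ (b + 1) ^ 8)
    (fun k => (h8' k).integral_pow_le (by norm_num) (by decide)) n
  have hS : MemLp (fun ω => ∑ k ∈ Finset.range n, Y k ω) ((8 : ℕ) : ℝ≥0∞) P :=
    memLp_finsetSum _ fun k _ => (h8' k).memLp
  -- The eighth root is exact because `484 ^ 4 = 22 ^ 8`.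
  have e : (484 * (b + 1) ^ 8) ^ 4 * (n : ℝ) ^ 4 = (sumConst b * √n) ^ 8 := by
    have : √(n : ℝ) ^ 8 = (n : ℝ) ^ 4 := by
      rw [show (8 : ℕ) = 2 * 4 by norm_num, pow_mul, Real.sq_sqrt (by positivity)]
    rw [mul_pow (sumConst b), this, sumConst]
    ring
  rw [e] at hsum
  have := LpLE.of_integral_pow_le (by norm_num) (by decide) hS
    (by unfold sumConst; positivity) hsum
  exact_mod_cast this

theorem SteinSequence.lpLE_sum (h : SteinSequence P X J τ τ' b) (n : ℕ) :
    LpLE P 8 (fun ω => ∑ k ∈ Finset.range n, X k ω) (sumConst b * √n) :=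
  lpLE_sum_range h.measurable h.indep h.mean (fun k => (h.lpLE k).mono (by linarith)) h.nonneg n

theorem SteinSequence.integral_kernel (h : SteinSequence P X J τ τ' b) (k : ℕ) :
    ∫ ω, τ k (X k ω) ∂P = 1 := by
  have := Measure.isProbabilityMeasure_map (μ := P) (h.measurable k).aemeasurable
  have hm := (h.measurable k).aemeasurable (μ := P)
  have hτ := (h.kernel k).measurable
  have key := (h.kernel k).integral_eq_integral_sq
    ((memLp_map_measure_iff aestronglyMeasurable_id hm).2
      ((h.lpLE k).mono_exponent (by norm_num)).memLp)
    ((integrable_map_measure hτ.aestronglyMeasurable hm).2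
      ((h.lpLE_kernel k).memLp.integrable (by norm_num)))
  rw [integral_map hm hτ.aestronglyMeasurable, integral_map hm (by fun_prop)] at key
  rw [key, h.integral_sq]

theorem SteinSequence.lpLE_sum_kernel (h : SteinSequence P X J τ τ' b) (n : ℕ) :
    LpLE P 8 (fun ω => ∑ k ∈ Finset.range n, τ k (X k ω) - n) (sumConst b * √n) := by
  have hτ := fun k => (h.kernel k).measurable
  have hX := h.measurable
  have := lpLE_sum_range (P := P) (Y := fun k ω => τ k (X k ω) - 1) (b := b)
    (fun k => by have := hX k; have := hτ k; fun_prop)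
    (h.indep.comp (fun k x => τ k x - 1) fun k => (hτ k).sub_const 1)
    (fun k => by
      rw [integral_sub ((h.lpLE_kernel k).memLp.integrable (by norm_num)) (integrable_const _),
        h.integral_kernel]
      simp)
    (fun k => by
      have := (h.lpLE_kernel k).add (LpLE.const (P := P) (p := 8) (-1) (by norm_num)) (by norm_num)
      simpa [sub_eq_add_neg] using this) h.nonneg n
  simpa [Finset.sum_sub_distrib] using this

theorem SteinSequence.integral_sum_sq (h : SteinSequence P X J τ τ' b) (n : ℕ) :
    ∫ ω, (∑ k ∈ Finset.range n, X k ω) ^ 2 ∂P = n := by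
  have h2 : ∀ k, MemLp (X k) 2 P := fun k => ((h.lpLE k).mono_exponent (by norm_num)).memLp
  have hv : Var[∑ k ∈ Finset.range n, X k; P] = n := by
    rw [IndepFun.variance_sum (fun k _ => h2 k) fun i _ j _ hij => h.indep.indepFun hij]
    simp [h.var]
  rw [variance_of_integral_eq_zero] at hv
  · simpa using hv
  · exact (Finset.aemeasurable_sum _ fun k _ => (h.measurable k).aemeasurable)
  · simp only [Finset.sum_apply]
    rw [integral_finsetSum _ fun k _ => (h2 k).integrable one_le_two]
    simp [h.mean]

/-- The statistic is approximately linear. -/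
theorem SteinSequence.lpLE_statF_sub (h : SteinSequence P X J τ τ' b)
    (hH : IsSmoothTransform H M₁ M₂) {n : ℕ} (hn : 1 ≤ n) :
    LpLE P 2 (fun ω => statF P X H n ω - deriv H 0 / √n * ∑ k ∈ Finset.range n, X k ω)
      (linConst b M₂ / √n) ∧ ∫ ω, statF P X H n ω ∂P = 0 := by
  have hn0 : (0 : ℝ) < n := by exact_mod_cast hn
  have hM2 : 0 ≤ M₂ := (abs_nonneg _).trans (hH.abs_deriv_deriv_le 0)
  have hX := h.measurable
  have hHm : Measurable H := hH.differentiable.continuous.measurable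
  set S : Ω → ℝ := fun ω => ∑ k ∈ Finset.range n, X k ω with hS
  have hSm : Measurable S := by simp only [hS]; fun_prop
  set c := deriv H 0 with hc
  -- The Taylor remainder is at most `M₂ (S/n)²`. Since `S` has order `√n` in `L⁸`, `R` has order
  -- `1/n` in `L⁴`, hence in `L²`, and `√n R` has order `1/√n`.
  set R : Ω → ℝ := fun ω => H (S ω / n) - H 0 - c * (S ω / n) with hR
  have hRm : Measurable R := by simp only [hR]; fun_prop
  have hS8 := h.lpLE_sum n
  have hS4 := hS8.mul (r := 4) hS8
  have hRL4 : LpLE P 4 R (M₂ / n ^ 2 * (sumConst b * √n * (sumConst b * √n))) := by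
    refine hS4.of_ae_abs_le hRm.aestronglyMeasurable (by positivity) (ae_of_all _ fun ω => ?_)
    refine ((abs_sub_sub_mul_le hH.differentiable hH.differentiable_deriv hH.abs_deriv_deriv_le
      (S ω / n)).2).trans (le_of_eq ?_)
    rw [abs_mul, ← sq, sq_abs]
    simp only [hS]
    field_simp
  have hRL : LpLE P 2 R (linConst b M₂ / n) := by
    refine (hRL4.mono_exponent (by norm_num)).mono (le_of_eq ?_)
    have : √(n : ℝ) * √n = n := Real.mul_self_sqrt hn0.le
    rw [show sumConst b * √n * (sumConst b * √n) = sumConst b ^ 2 * (√(n : ℝ) * √n) by ring, this,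
      linConst]
    field_simp
  have hRi : Integrable R P := hRL.memLp.integrable one_le_two
  have hSi : Integrable S P := hS8.memLp.integrable (by norm_num)
  have hSmean : ∫ ω, S ω ∂P = 0 := by
    simp only [hS]
    rw [integral_finsetSum _ fun k _ => (h.lpLE k).memLp.integrable (by norm_num)]
    simp [h.mean]
  have hHR : ∀ ω, H (sampleMean X n ω) = R ω + H 0 + c / n * S ω := by
    intro ω
    simp only [sampleMean, hR, hS]
    ring
  have hHi : Integrable (fun ω => H (sampleMean X n ω)) P := by
    simp only [hHR]
    exact (hRi.add (integrable_const _)).add (hSi.const_mul _)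
  have hmean : ∫ ω, H (sampleMean X n ω) ∂P = ∫ ω, R ω ∂P + H 0 := by
    have i1 : Integrable (fun ω => R ω + H 0) P := hRi.add (integrable_const _)
    simp only [hHR]
    rw [integral_add i1 (hSi.const_mul _), integral_add hRi (integrable_const _),
      integral_const_mul, hSmean]
    simp
  have hsn : √(n : ℝ) / n = 1 / √n := by
    rw [div_eq_div_iff hn0.ne' (by positivity), Real.mul_self_sqrt hn0.le, one_mul]
  have hA : ∀ ω, statF P X H n ω - c / √n * S ω = √n * (R ω - ∫ ω', R ω' ∂P) := by
    intro ω
    rw [statF, hmean, hHR]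
    have : √(n : ℝ) * (c / n * S ω) = c / √n * S ω := by
      rw [show √(n : ℝ) * (c / n * S ω) = c * S ω * (√(n : ℝ) / n) by ring, hsn]; ring
    linear_combination this
  constructor
  · have hmem : MemLp (fun ω => √n * (R ω - ∫ ω', R ω' ∂P)) ((2 : ℕ) : ℝ≥0∞) P := by
      have := (hRL.memLp.sub (memLp_const (∫ ω', R ω' ∂P))).const_mul (√n)
      exact_mod_cast this
    change LpLE P 2 (fun ω => statF P X H n ω - c / √n * S ω) _
    rw [funext hA]
    have hL0 : 0 ≤ linConst b M₂ := by unfold linConst; positivity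
    have := LpLE.of_integral_pow_le (a := linConst b M₂ / √n) (by norm_num) (by decide) hmem
      (by positivity) (by
        simp only [mul_pow, Real.sq_sqrt hn0.le]
        rw [integral_const_mul]
        -- Subtracting the mean does not increase the second moment.
        have h1 : ∫ ω, (R ω - ∫ ω', R ω' ∂P) ^ 2 ∂P ≤ ∫ ω, R ω ^ 2 ∂P := by
          rw [← variance_eq_integral hRm.aemeasurable]
          exact variance_le_expectation_sq hRm.aestronglyMeasurable
        have h2 : ∫ ω, R ω ^ 2 ∂P ≤ (linConst b M₂ / n) ^ 2 :=
          LpLE.integral_pow_le (by norm_num) (by decide) (by exact_mod_cast hRL)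
        calc (n : ℝ) * ∫ ω, (R ω - ∫ ω', R ω' ∂P) ^ 2 ∂P ≤ n * (linConst b M₂ / n) ^ 2 := by
              gcongr; exact h1.trans h2
          _ = (linConst b M₂ / √n) ^ 2 := by
              rw [div_pow, div_pow, Real.sq_sqrt hn0.le]; field_simp)
    exact_mod_cast this
  · simp only [statF]
    rw [integral_const_mul, integral_sub hHi (integrable_const _)]
    simp

theorem SteinSequence.memLp_statF (h : SteinSequence P X J τ τ' b)
    (hH : IsSmoothTransform H M₁ M₂) {n : ℕ} (hn : 1 ≤ n) : MemLp (statF P X H n) 2 P := by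
  have h1 := (h.lpLE_statF_sub hH hn).1.memLp
  have h2 : MemLp (fun ω => deriv H 0 / √n * ∑ k ∈ Finset.range n, X k ω) 2 P :=
    ((h.lpLE_sum n).mono_exponent (by norm_num)).memLp.const_mul _
  convert h1.add h2 using 1
  funext ω
  simp

/-- Write `F_n = u + A` with `u = H'(0) S / √n` and `A` the linearization error. A weighted Young
inequality gives `|F_n² - u²| ≤ u² / √n + (√n + 1) A²`, where `E[u²] = H'(0)²` and `E[A²]` is of
order `1/n`. -/
theorem SteinSequence.abs_variance_statF_sub_le (h : SteinSequence P X J τ τ' b)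
    (hH : IsSmoothTransform H M₁ M₂) {n : ℕ} (hn : 1 ≤ n) :
    |Var[statF P X H n; P] - deriv H 0 ^ 2| ≤ varConst b M₁ M₂ / √n := by
  have hn0 : (0 : ℝ) < n := by exact_mod_cast hn
  obtain ⟨hA, hmean⟩ := h.lpLE_statF_sub hH hn
  have hFm := h.measurable_statF hH n
  rw [variance_of_integral_eq_zero hFm.aemeasurable hmean]
  set c := deriv H 0 with hc
  set r : ℝ := √n with hr
  have hr1 : 1 ≤ r := Real.one_le_sqrt.2 (by exact_mod_cast hn)
  have hr0 : 0 < r := by linarith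
  have hrn : r ^ 2 = n := Real.sq_sqrt hn0.le
  set S : Ω → ℝ := fun ω => ∑ k ∈ Finset.range n, X k ω with hS
  set A : Ω → ℝ := fun ω => statF P X H n ω - c / r * S ω with hAdef
  have hA2 : ∫ ω, A ω ^ 2 ∂P ≤ (linConst b M₂ / r) ^ 2 :=
    LpLE.integral_pow_le (by norm_num) (by decide) (by exact_mod_cast hA)
  have hAi : Integrable (fun ω => A ω ^ 2) P := hA.memLp.integrable_sq
  have hSi : Integrable (fun ω => S ω ^ 2) P :=
    ((h.lpLE_sum n).mono_exponent (q := 2) (by norm_num)).memLp.integrable_sq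
  have hFi : Integrable (fun ω => statF P X H n ω ^ 2) P := (h.memLp_statF hH hn).integrable_sq
  have hSsq : ∫ ω, S ω ^ 2 ∂P = n := h.integral_sum_sq n
  have e1 : ∫ ω, (c / r) ^ 2 * S ω ^ 2 ∂P = c ^ 2 := by
    rw [integral_const_mul, hSsq, div_pow, hrn]; field_simp
  have e2 : ∫ ω, (statF P X H n ω ^ 2 - (c / r) ^ 2 * S ω ^ 2) ∂P =
      ∫ ω, statF P X H n ω ^ 2 ∂P - c ^ 2 := by
    rw [integral_sub hFi (hSi.const_mul _), e1]
  have e3 : (∫ ω, (statF P X H n ^ 2) ω ∂P) = ∫ ω, statF P X H n ω ^ 2 ∂P := rfl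
  rw [← e2]
  have hpt : ∀ ω, |statF P X H n ω ^ 2 - (c / r) ^ 2 * S ω ^ 2| ≤
      1 / r * ((c / r) ^ 2 * S ω ^ 2) + (r + 1) * A ω ^ 2 := by
    intro ω
    have hF : statF P X H n ω = c / r * S ω + A ω := by simp only [hAdef]; ring
    rw [hF, ← mul_pow]
    generalize c / r * S ω = u
    generalize A ω = v
    have h1 : 0 ≤ 1 / r * (u - r * v) ^ 2 := by positivity
    have h2 : 0 ≤ 1 / r * (u + r * v) ^ 2 := by positivity
    have e4 : 1 / r * (u - r * v) ^ 2 = 1 / r * u ^ 2 - 2 * (u * v) + r * v ^ 2 := by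
      field_simp; ring
    have e5 : 1 / r * (u + r * v) ^ 2 = 1 / r * u ^ 2 + 2 * (u * v) + r * v ^ 2 := by
      field_simp; ring
    rw [abs_le]
    constructor <;> nlinarith [sq_nonneg v]
  have hint : Integrable (fun ω => 1 / r * ((c / r) ^ 2 * S ω ^ 2) + (r + 1) * A ω ^ 2) P :=
    ((hSi.const_mul _).const_mul _).add (hAi.const_mul _)
  calc |∫ ω, (statF P X H n ω ^ 2 - (c / r) ^ 2 * S ω ^ 2) ∂P|
      ≤ ∫ ω, |statF P X H n ω ^ 2 - (c / r) ^ 2 * S ω ^ 2| ∂P := abs_integral_le_integral_abs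
    _ ≤ ∫ ω, (1 / r * ((c / r) ^ 2 * S ω ^ 2) + (r + 1) * A ω ^ 2) ∂P :=
        integral_mono (hFi.sub (hSi.const_mul _)).abs hint hpt
    _ = 1 / r * c ^ 2 + (r + 1) * ∫ ω, A ω ^ 2 ∂P := by
        rw [integral_add ((hSi.const_mul _).const_mul _) (hAi.const_mul _),
          integral_const_mul (1 / r),
          e1, integral_const_mul (r + 1)]
    _ ≤ 1 / r * M₁ ^ 2 + (2 * r) * (linConst b M₂ / r) ^ 2 := by
        have : c ^ 2 ≤ M₁ ^ 2 := by
          rw [← sq_abs]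
          exact pow_le_pow_left₀ (abs_nonneg _) (hH.abs_deriv_le 0) 2
        have h3 : 0 ≤ ∫ ω, A ω ^ 2 ∂P := integral_nonneg fun ω => sq_nonneg _
        gcongr
        linarith
    _ = varConst b M₁ M₂ / r := by
        rw [varConst]; field_simp

end

/-! ### The variable `∇` and the Fisher distance of the normalized statistic. -/

section

variable {Ω : Type*} [MeasurableSpace Ω] {P : Measure Ω}
  {X : ℕ → Ω → ℝ} {J : ℕ → Set ℝ} {τ τ' : ℕ → ℝ → ℝ} {H : ℝ → ℝ} {b M₁ M₂ : ℝ}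

/-- The `L⁴` bound for the derivative of `∇` along the Stein kernels. -/
theorem SteinSequence.lpLE_deriv_nabla (h : SteinSequence P X J τ τ' b)
    (hH : IsSmoothTransform H M₁ M₂) {n : ℕ} (hn : 1 ≤ n) :
    LpLE P 4 (fun ω => deriv H 0 * deriv (deriv H) ((∑ k ∈ Finset.range n, X k ω) / n) / n ^ 2 *
        (∑ k ∈ Finset.range n, τ k (X k ω)) ^ 2 +
        deriv H 0 * deriv H ((∑ k ∈ Finset.range n, X k ω) / n) / n *
          ∑ k ∈ Finset.range n, τ k (X k ω) * τ' k (X k ω))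
      ((M₁ * M₂ + M₁ ^ 2) * b ^ 2) := by
  have hn0 : (0 : ℝ) < n := by exact_mod_cast hn
  have hM1 : 0 ≤ M₁ := (abs_nonneg _).trans (hH.abs_deriv_le 0)
  have hM2 : 0 ≤ M₂ := (abs_nonneg _).trans (hH.abs_deriv_deriv_le 0)
  have hX := h.measurable
  have hτ := fun k => (h.kernel k).measurable
  have hτ' := fun k => (h.kernel k).measurable_deriv
  have hH'm : Measurable (deriv H) := measurable_deriv H
  have hH''m : Measurable (deriv (deriv H)) := measurable_deriv _
  have hc : |deriv H 0| ≤ M₁ := hH.abs_deriv_le 0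
  -- No cancellation is needed: the triangle inequality gives `T²` of order `n²` and `U` of order
  -- `n`, matching the prefactors `1/n²` and `1/n`.
  have hT := LpLE.sum h.lpLE_kernel (by norm_num) n
  have hTT := hT.mul (r := 4) hT
  have hU := LpLE.sum (fun k => (h.lpLE_kernel k).mul (r := 4) (h.lpLE_deriv k)) (by norm_num) n
  have h1 : LpLE P 4 (fun ω => deriv H 0 *
      deriv (deriv H) ((∑ k ∈ Finset.range n, X k ω) / n) / n ^ 2 *
        (∑ k ∈ Finset.range n, τ k (X k ω)) ^ 2) (M₁ * M₂ / n ^ 2 * (n * b * (n * b))) := by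
    refine hTT.of_ae_abs_le (Measurable.aestronglyMeasurable (by fun_prop)) (by positivity)
      (ae_of_all _ fun ω => ?_)
    rw [abs_mul, abs_div, abs_mul, abs_pow (n : ℝ), Nat.abs_cast, ← sq]
    gcongr
    exact hH.abs_deriv_deriv_le _
  have h2 : LpLE P 4 (fun ω => deriv H 0 * deriv H ((∑ k ∈ Finset.range n, X k ω) / n) / n *
      ∑ k ∈ Finset.range n, τ k (X k ω) * τ' k (X k ω)) (M₁ ^ 2 / n * (n * (b * b))) := by
    refine hU.of_ae_abs_le (Measurable.aestronglyMeasurable (by fun_prop)) (by positivity)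
      (ae_of_all _ fun ω => ?_)
    rw [abs_mul, abs_div, abs_mul, Nat.abs_cast, sq M₁]
    gcongr
    exact hH.abs_deriv_le _
  refine (h1.add h2 (by norm_num)).mono (le_of_eq ?_)
  field_simp

/-- Finiteness of `‖Y⁻¹‖₈` as an `L⁸` bound. -/
theorem lpLE_inv_of_invNorm_ne_top {Y : Ω → ℝ} (hY : AEMeasurable Y P)
    (h : invNorm P Y 8 ≠ ∞) :
    (∀ᵐ ω ∂P, Y ω ≠ 0) ∧ LpLE P 8 (fun ω => (Y ω)⁻¹) (invNorm P Y 8).toReal := by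
  have hint : ∫⁻ ω, (‖Y ω‖ₑ⁻¹) ^ (8 : ℝ) ∂P ≠ ∞ := by
    intro htop
    rw [invNorm, htop, ENNReal.top_rpow_of_pos (by norm_num)] at h
    exact h rfl
  -- In `ℝ≥0∞` the inverse of `0` is `∞`, so finiteness excludes zeros almost surely; off them it
  -- agrees with the real inverse.
  have h0 : ∀ᵐ ω ∂P, Y ω ≠ 0 := by
    filter_upwards [ae_lt_top' (hY.enorm.inv.pow_const _) hint] with ω hω h0
    simp [h0] at hω
  refine ⟨h0, hY.inv.aestronglyMeasurable, ENNReal.toReal_nonneg, ?_⟩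
  rw [ENNReal.ofReal_toReal h, eLpNorm_eq_lintegral_rpow_enorm_toReal (by norm_num) (by norm_num),
    invNorm]
  simp only [ENNReal.toReal_ofNat]
  gcongr ?_ ^ _
  refine le_of_eq (lintegral_congr_ae ?_)
  filter_upwards [h0] with ω hω
  rw [enorm_inv hω]

variable [IsProbabilityMeasure P]

/-- The `L⁴` distance of `∇` to the variance. -/
theorem SteinSequence.lpLE_nabla_sub (h : SteinSequence P X J τ τ' b)
    (hH : IsSmoothTransform H M₁ M₂) {n : ℕ} (hn : 1 ≤ n) :
    LpLE P 4 (fun ω => deriv H 0 * deriv H ((∑ k ∈ Finset.range n, X k ω) / n) / n *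
        ∑ k ∈ Finset.range n, τ k (X k ω) - Var[statF P X H n; P])
      (nablaConst b M₁ M₂ / √n) := by
  have hn0 : (0 : ℝ) < n := by exact_mod_cast hn
  have hM1 : 0 ≤ M₁ := (abs_nonneg _).trans (hH.abs_deriv_le 0)
  have hM2 : 0 ≤ M₂ := (abs_nonneg _).trans (hH.abs_deriv_deriv_le 0)
  have hX := h.measurable
  have hτ := fun k => (h.kernel k).measurable
  have hH'm : Measurable (deriv H) := measurable_deriv H
  have hvar := h.abs_variance_statF_sub_le hH hn
  set v := Var[statF P X H n; P]
  set c := deriv H 0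
  have hc : |c| ≤ M₁ := hH.abs_deriv_le 0
  have hS := (h.lpLE_sum n).mono_exponent (q := 4) (by norm_num)
  have hT := (h.lpLE_sum_kernel n).mono_exponent (q := 4) (by norm_num)
  -- The difference splits into the fluctuation of `T / n` about `1`, that of `H'(X̄)` about `c`,
  -- and the deterministic error `c² - v`.
  have h1 : LpLE P 4 (fun ω => c * deriv H ((∑ k ∈ Finset.range n, X k ω) / n) / n *
      (∑ k ∈ Finset.range n, τ k (X k ω) - n)) (M₁ ^ 2 / n * (sumConst b * √n)) := by
    refine hT.of_ae_abs_le (Measurable.aestronglyMeasurable (by fun_prop)) (by positivity)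
      (ae_of_all _ fun ω => ?_)
    rw [abs_mul, abs_div, abs_mul, Nat.abs_cast, sq]
    gcongr
    exact hH.abs_deriv_le _
  have h2 : LpLE P 4 (fun ω => c * (deriv H ((∑ k ∈ Finset.range n, X k ω) / n) - c))
      (M₁ * M₂ / n * (sumConst b * √n)) := by
    refine hS.of_ae_abs_le (Measurable.aestronglyMeasurable (by fun_prop)) (by positivity)
      (ae_of_all _ fun ω => ?_)
    rw [abs_mul]
    calc _ ≤ M₁ * (M₂ * |(∑ k ∈ Finset.range n, X k ω) / n|) := mul_le_mul hc
          (abs_sub_sub_mul_le hH.differentiable hH.differentiable_deriv hH.abs_deriv_deriv_le _).1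
          (abs_nonneg _) hM1
      _ = _ := by rw [abs_div, Nat.abs_cast]; ring
  have h3 : LpLE P 4 (fun _ => c ^ 2 - v) (varConst b M₁ M₂ / √n) :=
    (LpLE.const _ (by norm_num)).mono (by rwa [abs_sub_comm])
  have h123 := (h1.add h2 (by norm_num)).add h3 (by norm_num)
  have hsn : √(n : ℝ) / n = 1 / √n := by
    rw [div_eq_div_iff hn0.ne' (by positivity), Real.mul_self_sqrt hn0.le, one_mul]
  convert h123 using 1
  · funext ω
    field_simp
    ring
  · rw [show M₁ ^ 2 / n * (sumConst b * √n) = M₁ ^ 2 * sumConst b * (√n / n) by ring,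
      show M₁ * M₂ / n * (sumConst b * √n) = M₁ * M₂ * sumConst b * (√n / n) by ring, hsn,
      nablaConst]
    ring

/-- The Fisher information distance of the normalized statistic, when `∇⁻¹` is bounded in `L⁸`. -/
theorem SteinSequence.fisherDist_le (h : SteinSequence P X J τ τ' b)
    (hH : IsSmoothTransform H M₁ M₂) (hH0 : deriv H 0 ≠ 0) {n : ℕ} (hn : 1 ≤ n)
    (hv : 0 < Var[statF P X H n; P]) {D : Ω → ℝ}
    (hD : D = fun ω => deriv H 0 * deriv H ((∑ k ∈ Finset.range n, X k ω) / n) / n *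
      ∑ k ∈ Finset.range n, τ k (X k ω)) (hD0 : ∀ᵐ ω ∂P, D ω ≠ 0) {K : ℝ}
    (hK : LpLE P 8 (fun ω => (D ω)⁻¹) K) :
    fisherDist P (fun ω => (√(Var[statF P X H n; P]))⁻¹ * statF P X H n ω) ≤
      ENNReal.ofReal (3 * scoreConst b M₁ M₂ ^ 2 / (n * Var[statF P X H n; P]) *
        (1 + K ^ 2 + K ^ 4)) := by
  have hn0 : (0 : ℝ) < n := by exact_mod_cast hn
  have hM1 : 0 ≤ M₁ := (abs_nonneg _).trans (hH.abs_deriv_le 0)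
  have hM2 : 0 ≤ M₂ := (abs_nonneg _).trans (hH.abs_deriv_deriv_le 0)
  have hb := h.nonneg
  have hK0 := hK.nonneg
  have hX := h.measurable
  have hFm := h.measurable_statF hH n
  have hF2 := h.memLp_statF hH hn
  obtain ⟨hA, hmean⟩ := h.lpLE_statF_sub hH hn
  have hvar := h.abs_variance_statF_sub_le hH hn
  have hN := h.lpLE_nabla_sub hH hn
  have hQ := h.lpLE_deriv_nabla hH hn
  set c := deriv H 0 with hc
  have hcM : |c| ≤ M₁ := hH.abs_deriv_le 0
  set v := Var[statF P X H n; P] with hvdef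
  set σ := √v with hσ
  have hσ0 : 0 < σ := Real.sqrt_pos.2 hv
  have hσ2 : σ ^ 2 = v := Real.sq_sqrt hv.le
  set r : ℝ := √n with hr
  have hr1 : 1 ≤ r := Real.one_le_sqrt.2 (by exact_mod_cast hn)
  have hr0 : 0 < r := by linarith
  have hrn : r ^ 2 = n := Real.sq_sqrt hn0.le
  set S : Ω → ℝ := fun ω => ∑ k ∈ Finset.range n, X k ω with hS
  set T : Ω → ℝ := fun ω => ∑ k ∈ Finset.range n, τ k (X k ω) with hT
  set U : Ω → ℝ := fun ω => ∑ k ∈ Finset.range n, τ k (X k ω) * τ' k (X k ω) with hU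
  set d : ℝ → ℝ := fun s => c * deriv H (s / n) / n with hd
  set d' : ℝ → ℝ := fun s => c * deriv (deriv H) (s / n) / n ^ 2 with hd'
  set Q : Ω → ℝ := fun ω => d' (S ω) * T ω ^ 2 + d (S ω) * U ω with hQdef
  have hSK : LpLE P 4 (fun ω => S ω * (D ω)⁻¹) (sumConst b * r * K) := (h.lpLE_sum n).mul hK
  have hQK : LpLE P 2 (fun ω => Q ω * ((D ω)⁻¹ * (D ω)⁻¹))
      ((M₁ * M₂ + M₁ ^ 2) * b ^ 2 * (K * K)) :=
    LpLE.mul (p := 4) (q := 4) hQ (hK.mul (r := 4) hK)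
  -- The weight obtained by solving `integral_sum_inv`, with `κ = r / (σ c)`, for the expectation of
  -- `ψ`.
  set W : Ω → ℝ := fun ω => σ * c / r * (S ω * (D ω)⁻¹ + Q ω * ((D ω)⁻¹ * (D ω)⁻¹)) with hW
  have hi1 : Integrable (fun ω => S ω * (D ω)⁻¹) P := hSK.memLp.integrable (by norm_num)
  have hi2 : Integrable (fun ω => Q ω * ((D ω)⁻¹ * (D ω)⁻¹)) P := hQK.memLp.integrable one_le_two
  have hWi : Integrable W P := (hi1.add hi2).const_mul _
  have hFi : Integrable (fun ω => σ⁻¹ * statF P X H n ω) P :=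
    (hF2.integrable one_le_two).const_mul _
  have hderiv : ∀ s, HasDerivAt d (d' s) s := by
    intro s
    have h1 : HasDerivAt (fun s : ℝ => s / n) (1 / n) s := (hasDerivAt_id s).div_const _
    have h2 : HasDerivAt (fun s : ℝ => deriv H (s / n)) (deriv (deriv H) (s / n) * (1 / n)) s :=
      HasDerivAt.comp (h₂ := deriv H) s (hH.differentiable_deriv (s / n)).hasDerivAt h1
    refine ((h2.const_mul c).div_const _).congr_deriv ?_
    simp only [hd']
    field_simp
  set f : ℝ → ℝ := fun s => σ⁻¹ * (r * (H (s / n) - ∫ ω', H (sampleMean X n ω') ∂P)) with hf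
  have hfd : ∀ s, HasDerivAt f (r / (σ * c) * d s) s := by
    intro s
    have h1 : HasDerivAt (fun s : ℝ => s / n) (1 / n) s := (hasDerivAt_id s).div_const _
    have h2 : HasDerivAt (fun s : ℝ => H (s / n)) (deriv H (s / n) * (1 / n)) s :=
      (hH.differentiable (s / n)).hasDerivAt.comp s h1
    refine (((h2.sub_const _).const_mul r).const_mul σ⁻¹).congr_deriv ?_
    simp only [hd]
    field_simp
  have hfS : ∀ ω, f (S ω) = σ⁻¹ * statF P X H n ω := fun ω => rfl
  have hmain := fisherDist_le_eLpNorm (P := P) (F := fun ω => σ⁻¹ * statF P X H n ω) (W := W)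
    (hFm.const_mul _) hFi hWi (by
      intro φ ψ C hφ hψ hφC hψC
      have key := integral_sum_inv h.measurable h.indep h.kernel
        (fun k => ((h.lpLE k).mono_exponent (by norm_num)).memLp)
        (fun k => ((h.lpLE_kernel k).mono_exponent (by norm_num)).memLp)
        (fun k => ((h.lpLE_deriv k).mono_exponent (by norm_num)).memLp)
        (C := max C (max (M₁ * M₁ / n) (M₁ * M₂ / n ^ 2)))
        hfd hderiv (by
          have : Measurable (deriv (deriv H)) := measurable_deriv _
          simp only [hd']; fun_prop)
        (fun s => le_max_of_le_right (le_max_of_le_left (by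
          simp only [hd]
          rw [abs_div, abs_mul, Nat.abs_cast]
          gcongr
          exact hH.abs_deriv_le _)))
        (fun s => le_max_of_le_right (le_max_of_le_right (by
          simp only [hd']
          rw [abs_div, abs_mul, abs_pow, Nat.abs_cast]
          gcongr
          exact hH.abs_deriv_deriv_le _)))
        hφ hψ (fun x => le_max_of_le_left (hφC x)) (fun x => le_max_of_le_left (hψC x)) n hS hT hU
        hD hD0 hi1 hi2
      simp only [hfS] at key
      have e : ∫ ω, φ (σ⁻¹ * statF P X H n ω) * W ω ∂P = σ * c / r *
          ∫ ω, φ (σ⁻¹ * statF P X H n ω) * (S ω * (D ω)⁻¹ + Q ω * ((D ω)⁻¹ * (D ω)⁻¹)) ∂P := by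
        rw [← integral_const_mul]
        refine integral_congr_ae (ae_of_all _ fun ω => ?_)
        simp only [hW]; ring
      rw [e, ← key]
      field_simp)
  have hmean' : ∫ ω, σ⁻¹ * statF P X H n ω ∂P = 0 := by rw [integral_const_mul, hmean, mul_zero]
  have hvar' : Var[fun ω => σ⁻¹ * statF P X H n ω; P] = 1 := by
    rw [variance_const_mul, ← hvdef, ← hσ2]; field_simp
  rw [hmean', hvar'] at hmain
  have hvle : v ≤ M₁ ^ 2 + varConst b M₁ M₂ := by
    have h1 : c ^ 2 ≤ M₁ ^ 2 := by
      rw [← sq_abs]; exact pow_le_pow_left₀ (abs_nonneg _) hcM 2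
    have h2 : varConst b M₁ M₂ / r ≤ varConst b M₁ M₂ :=
      div_le_self (by unfold varConst; positivity) hr1
    have h3 := (abs_le.1 hvar).2
    linarith
  have hG : LpLE P 2 (fun ω => (σ⁻¹ * statF P X H n ω - 0) / 1 - W ω)
      (scoreConst b M₁ M₂ * (1 + K + K ^ 2) / (σ * r)) := by
    -- Almost surely `F - W` is `σ⁻¹` times the sum of the linearization error, `(c/r) (S/D) (D -
    -- v)` and `-(v c/r) Q/D²`; this uses `D ≠ 0` and `σ² = v`.
    have h2 : LpLE P 2 (fun ω => S ω * (D ω)⁻¹ * (D ω - v))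
        (sumConst b * r * K * (nablaConst b M₁ M₂ / r)) :=
      hSK.mul (q := 4) (by simpa only [hD] using hN)
    have h3 := ((hA.add (h2.const_mul (c / r)) one_le_two).add
      (hQK.const_mul (-(v * c / r))) one_le_two).const_mul σ⁻¹
    have hκ : 0 ≤ sumConst b := by unfold sumConst; positivity
    have hlin : 0 ≤ linConst b M₂ := by unfold linConst; positivity
    have hvc : 0 ≤ varConst b M₁ M₂ := by unfold varConst; positivity
    have hnc : 0 ≤ nablaConst b M₁ M₂ := by unfold nablaConst; positivity
    refine LpLE.mono (a := |σ⁻¹| * (linConst b M₂ / r + |c / r| * (sumConst b * r * K *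
      (nablaConst b M₁ M₂ / r)) + |-(v * c / r)| * ((M₁ * M₂ + M₁ ^ 2) * b ^ 2 * (K * K)))) ?_ ?_
    · refine ⟨?_, h3.nonneg, ?_⟩
      · simp only [sub_zero, div_one]
        exact hFi.1.sub hWi.1
      · refine le_trans (le_of_eq (eLpNorm_congr_ae ?_)) h3.le
        filter_upwards [hD0] with ω hω
        simp only [hW]
        change _ = σ⁻¹ * (statF P X H n ω - c / r * S ω + c / r * (S ω * (D ω)⁻¹ * (D ω - v)) +
          -(v * c / r) * (Q ω * ((D ω)⁻¹ * (D ω)⁻¹)))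
        rw [← hσ2]
        field_simp
        ring
    · rw [abs_neg, abs_div, abs_div, abs_mul, abs_inv, abs_of_pos hσ0, abs_of_pos hr0,
        abs_of_pos hv]
      have e : σ⁻¹ * (linConst b M₂ / r + |c| / r * (sumConst b * r * K *
          (nablaConst b M₁ M₂ / r)) + v * |c| / r * ((M₁ * M₂ + M₁ ^ 2) * b ^ 2 * (K * K))) =
          (linConst b M₂ + |c| * sumConst b * nablaConst b M₁ M₂ * K +
            v * (|c| * ((M₁ * M₂ + M₁ ^ 2) * b ^ 2)) * K ^ 2) / (σ * r) := by
        field_simp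
      rw [e]
      gcongr
      have a1 : |c| * sumConst b * nablaConst b M₁ M₂ ≤ M₁ * sumConst b * nablaConst b M₁ M₂ := by
        gcongr
      have a2 : v * (|c| * ((M₁ * M₂ + M₁ ^ 2) * b ^ 2)) ≤
          (M₁ ^ 2 + varConst b M₁ M₂) * (M₁ * ((M₁ * M₂ + M₁ ^ 2) * b ^ 2)) := by
        gcongr
      have a3 : 0 ≤ M₁ * sumConst b * nablaConst b M₁ M₂ := by positivity
      have a4 : 0 ≤ (M₁ ^ 2 + varConst b M₁ M₂) * (M₁ * ((M₁ * M₂ + M₁ ^ 2) * b ^ 2)) := by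
        positivity
      have b1 : linConst b M₂ ≤ scoreConst b M₁ M₂ := by unfold scoreConst; linarith
      have b2 : |c| * sumConst b * nablaConst b M₁ M₂ ≤ scoreConst b M₁ M₂ := by
        unfold scoreConst; linarith
      have b3 : v * (|c| * ((M₁ * M₂ + M₁ ^ 2) * b ^ 2)) ≤ scoreConst b M₁ M₂ := by
        unfold scoreConst; linarith
      calc _ ≤ scoreConst b M₁ M₂ + scoreConst b M₁ M₂ * K + scoreConst b M₁ M₂ * K ^ 2 := by
            gcongr
        _ = _ := by ring
  refine hmain.trans ((pow_le_pow_left' hG.le 2).trans ?_)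
  rw [← ENNReal.ofReal_pow hG.nonneg]
  refine ENNReal.ofReal_le_ofReal ?_
  rw [div_pow, mul_pow, mul_pow, hσ2, hrn, mul_comm v, div_mul_eq_mul_div]
  refine div_le_div_of_nonneg_right ?_ (by positivity)
  -- Cauchy–Schwarz, the source of the factor `3` in the final constant.
  have : (1 + K + K ^ 2) ^ 2 ≤ 3 * (1 + K ^ 2 + K ^ 4) := by
    nlinarith [sq_nonneg (1 - K), sq_nonneg (K - K ^ 2), sq_nonneg (1 - K ^ 2)]
  nlinarith [sq_nonneg (scoreConst b M₁ M₂)]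

/-- Eighth moments at most `β` mean `L⁸` norms at most `β ^ (1/8)`. Cutting the kernels off changes
nothing almost surely, as `X k` lies in `J k`. -/
theorem exists_steinSequence {X : ℕ → Ω → ℝ} {p : ℕ → ℝ → ℝ} {β : ℝ≥0}
    (hX : ∀ k, Measurable (X k)) (hi : iIndepFun X P) (h0 : ∀ k, P[X k] = 0)
    (h1 : ∀ k, Var[X k; P] = 1) (hp : ∀ k, IsIntervalDensity (P.map (X k)) (p k))
    (hβ : momentBound P X p = β) :
    ∃ J : ℕ → Set ℝ, SteinSequence P X J (fun k => (J k).indicator (steinKernel (p k)))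
      (fun k => deriv (steinKernel (p k))) ((β : ℝ) ^ (((8 : ℕ) : ℝ)⁻¹)) := by
  have hb := hβ.le
  rw [momentBound, max_le_iff, max_le_iff] at hb
  have hmap := fun k => Measure.isProbabilityMeasure_map (μ := P) (hX k).aemeasurable
  have hXL : ∀ k, LpLE P 8 (X k) ((β : ℝ) ^ (((8 : ℕ) : ℝ)⁻¹)) := fun k => by
    have := LpLE.of_lintegral_pow_le (by norm_num : 8 ≠ 0)
      (hX k).aestronglyMeasurable ((le_iSup _ k).trans hb.1)
    exact_mod_cast this
  choose J hJ using fun k => (hp k).isSteinKernel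
    ((integrable_map_measure aestronglyMeasurable_id (hX k).aemeasurable).2
      ((hXL k).memLp.integrable (by norm_num)))
    ((integral_map (f := id) (hX k).aemeasurable aestronglyMeasurable_id).trans (h0 k))
  have hτm := fun k => (hJ k).measurable
  refine ⟨J, hX, hi, h0, h1, hJ, hXL, fun k => ?_, fun k => ?_⟩
  · have := LpLE.of_lintegral_pow_le (by norm_num : 8 ≠ 0)
      (f := fun ω => (J k).indicator (steinKernel (p k)) (X k ω)) (β := β)
      ((hτm k).comp (hX k)).aestronglyMeasurable (by
        refine (lintegral_mono_ae ?_).trans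
          ((le_iSup (fun k => ∫⁻ ω, ‖steinKernel (p k) (X k ω)‖ₑ ^ 8 ∂P) k).trans hb.2.1)
        filter_upwards [ae_of_ae_map (hX k).aemeasurable (hJ k).ae_mem] with ω hω
        rw [indicator_of_mem hω])
    exact_mod_cast this
  · have := LpLE.of_lintegral_pow_le (by norm_num : 8 ≠ 0)
      (f := fun ω => deriv (steinKernel (p k)) (X k ω)) (β := β)
      ((measurable_deriv _).comp (hX k)).aestronglyMeasurable
      ((le_iSup (fun k => ∫⁻ ω, ‖deriv (steinKernel (p k)) (X k ω)‖ₑ ^ 8 ∂P) k).trans hb.2.2)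
    exact_mod_cast this

theorem abs_le_of_iSup_enorm_eq {f : ℝ → ℝ} {M : ℝ≥0} (h : ⨆ x, ‖f x‖ₑ = M) (x : ℝ) :
    |f x| ≤ M := by
  have h1 : ‖f x‖ₑ ≤ M := h ▸ le_iSup (fun x => ‖f x‖ₑ) x
  rw [enorm_le_coe] at h1
  exact_mod_cast h1

end

end FisherCLT

end

/-! ### Conclusion, with the degenerate cases. -/

open FisherCLT in
theorem theorem4p2 (β M₁ M₂ : ℝ≥0) :
    ∃ C : ℝ, 0 < C ∧
      ∀ {Ω : Type*} [MeasurableSpace Ω] (P : Measure Ω) [IsProbabilityMeasure P]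
        (X : ℕ → Ω → ℝ) (p : ℕ → ℝ → ℝ) (H : ℝ → ℝ),
        (∀ k, Measurable (X k)) →
        iIndepFun X P →
        (∀ k, P[X k] = 0) →
        (∀ k, Var[X k; P] = 1) →
        (∀ k, FisherCLT.IsIntervalDensity (P.map (X k)) (p k)) →
        Differentiable ℝ H →
        Differentiable ℝ (deriv H) →
        (⨆ x, ‖deriv H x‖ₑ) = (M₁ : ℝ≥0∞) →
        (⨆ x, ‖deriv (deriv H) x‖ₑ) = (M₂ : ℝ≥0∞) →
        deriv H 0 ≠ 0 →
        FisherCLT.momentBound P X p = (β : ℝ≥0∞) →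
        ∀ n : ℕ, 1 ≤ n →
          |Var[FisherCLT.statF P X H n; P] - |deriv H 0| ^ 2| ≤ C / √n ∧
          FisherCLT.fisherDist P
              (fun ω => (√(Var[FisherCLT.statF P X H n; P]))⁻¹ * FisherCLT.statF P X H n ω) ≤
            ENNReal.ofReal C / (n * ENNReal.ofReal (Var[FisherCLT.statF P X H n; P])) *
              (1 + FisherCLT.invNorm P (FisherCLT.nablaF X p H n) 8 ^ 2
                + FisherCLT.invNorm P (FisherCLT.nablaF X p H n) 8 ^ 4) := by
  set b : ℝ := (β : ℝ) ^ (((8 : ℕ) : ℝ)⁻¹) with hb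
  have hvc : 0 ≤ varConst b M₁ M₂ := by unfold varConst; positivity
  have hC : 0 < 1 + varConst b M₁ M₂ + 3 * scoreConst b M₁ M₂ ^ 2 := by positivity
  -- The summand `1` keeps the constant positive, so that `C / 0 = ∞` in the case of zero variance
  -- and `C / (n σ²) * ∞ = ∞` in the case of infinite `‖∇⁻¹‖₈`.
  refine ⟨1 + varConst b M₁ M₂ + 3 * scoreConst b M₁ M₂ ^ 2, hC, ?_⟩
  intro Ω _ P _ X p H hX hi h0 h1 hp hH hH' hM1 hM2 hH0 hβ n hn
  obtain ⟨J, h⟩ := exists_steinSequence hX hi h0 h1 hp hβ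
  rw [← hb] at h
  have hsm : IsSmoothTransform H M₁ M₂ :=
    ⟨hH, hH', abs_le_of_iSup_enorm_eq hM1, abs_le_of_iSup_enorm_eq hM2⟩
  have hn0 : (0 : ℝ) < n := by exact_mod_cast hn
  constructor
  · rw [sq_abs]
    refine (h.abs_variance_statF_sub_le hsm hn).trans ?_
    gcongr
    nlinarith [sq_nonneg (scoreConst b M₁ M₂)]
  · set v := Var[statF P X H n; P] with hv
    have hden : (n : ℝ≥0∞) * ENNReal.ofReal v ≠ ∞ :=
      ENNReal.mul_ne_top (by simp) ENNReal.ofReal_ne_top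
    have hCne : ENNReal.ofReal (1 + varConst b M₁ M₂ + 3 * scoreConst b M₁ M₂ ^ 2) ≠ 0 := by
      simpa using hC
    rcases (variance_nonneg (statF P X H n) P).eq_or_lt with hv0 | hv0
    · rw [← hv] at hv0
      rw [← hv0, ENNReal.ofReal_zero, mul_zero, ENNReal.div_zero hCne, ENNReal.top_mul (by simp)]
      exact le_top
    · rw [← hv] at hv0
      by_cases htop : invNorm P (nablaF X p H n) 8 = ∞
      · rw [htop]
        have : ENNReal.ofReal (1 + varConst b M₁ M₂ + 3 * scoreConst b M₁ M₂ ^ 2) /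
            (n * ENNReal.ofReal v) ≠ 0 := ENNReal.div_ne_zero.2 ⟨hCne, hden⟩
        simp [ENNReal.mul_top this]
      -- The version of `∇` built from the cut-off kernels is everywhere defined as a measurable
      -- function and agrees almost surely with `nablaF`.
      · set D : Ω → ℝ := fun ω => deriv H 0 * deriv H ((∑ k ∈ Finset.range n, X k ω) / n) / n *
          ∑ k ∈ Finset.range n, (J k).indicator (steinKernel (p k)) (X k ω) with hD
        have hDm : Measurable D := by
          have := fun k => (h.kernel k).measurable
          have := measurable_deriv H
          simp only [hD]
          fun_prop
        have hDN : D =ᵐ[P] nablaF X p H n := by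
          have hmem : ∀ᵐ ω ∂P, ∀ k, X k ω ∈ J k := ae_all_iff.2 fun k =>
            ae_of_ae_map (hX k).aemeasurable (h.kernel k).ae_mem
          filter_upwards [hmem] with ω hω
          simp only [hD, nablaF, sampleMean]
          congr 1
          exact Finset.sum_congr rfl fun k _ => Set.indicator_of_mem (hω k) _
        have hNm : AEMeasurable (nablaF X p H n) P := hDm.aemeasurable.congr hDN
        obtain ⟨hN0, hNK⟩ := lpLE_inv_of_invNorm_ne_top hNm htop
        set K : ℝ := (invNorm P (nablaF X p H n) 8).toReal with hK
        have hKe : invNorm P (nablaF X p H n) 8 = ENNReal.ofReal K :=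
          (ENNReal.ofReal_toReal htop).symm
        have hD0 : ∀ᵐ ω ∂P, D ω ≠ 0 := by
          filter_upwards [hDN, hN0] with ω e hω
          rwa [e]
        have hDK : LpLE P 8 (fun ω => (D ω)⁻¹) K :=
          ⟨hDm.inv.aestronglyMeasurable, hNK.nonneg,
            (eLpNorm_congr_ae (hDN.fun_comp (·⁻¹))).le.trans hNK.le⟩
        refine (h.fisherDist_le hsm hH0 hn hv0 hD hD0 hDK).trans ?_
        have hK0 := hNK.nonneg
        rw [hKe, ← ENNReal.ofReal_natCast, ← ENNReal.ofReal_mul hn0.le,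
          ← ENNReal.ofReal_div_of_pos (by positivity), ← ENNReal.ofReal_pow hK0,
          ← ENNReal.ofReal_pow hK0, ← ENNReal.ofReal_one, ← ENNReal.ofReal_add zero_le_one
          (by positivity), ← ENNReal.ofReal_add (by positivity) (by positivity),
          ← ENNReal.ofReal_mul (by positivity)]
        refine ENNReal.ofReal_le_ofReal ?_
        gcongr
        linarith
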